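/- Let $\mathbb{D}$ be the open unit disc and $n\ge 2$. A rational inner function on $\mathbb{D}^n$ is a bounded holomorphic function $f$ on $\mathbb{D}^n$ that is a quotient of two polynomials, the denominator having no zero in $\mathbb{D}^n$, and that satisfies $\lim_{r\to1^-}|f(r\zeta)|=1$ for almost every $\zeta\in\mathbb{T}^n$. For $a\in\mathbb{D}$ put $\psi_a(z)=\frac{z-a}{1-\bar a z}$, and for $A=(A_1,\dots,A_n)\in\mathbb{D}^n$ put $\Psi_A=(\psi_{A_1},\dots,\psi_{A_n})$. For a polynomial $Q(z)=\sum_\alpha a_\alpha z^\alpha\in\mathbb{C}[z_1,\dots,z_n]$ let $\widetilde Q(z)=\sum_\alpha\overline{a_\alpha}z^\alpha$, let $\nu(Q)=(\nu_1(Q),\dots,\nu_n(Q))$, where $\nu_j(Q)$ is the degree of $Q$ in the variable $z_j$, and call $Q$ deficient in degree if the coefficient $a_{\nu(Q)}$ is $0$. A Blaschke product of degree $r$ is a function $c\prod_{i=1}^r\psi_{a_i}$ with $|c|=1$ and $a_1,\dots,a_r\in\mathbb{D}$. Let $X_1,X_2,X_3$ be three distinct points of $\mathbb{D}^n$ and let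 $w_1,w_2,w_3\in\mathbb{D}$. For $j=1,2$ put $w_j'=\psi_{w_3}(w_j)$ and $X_j'=\Psi_{X_3}(X_j)=(X_{j,1}',\dots,X_{j,n}')$. **Theorem.** There is a rational inner function $F$ on $\mathbb{D}^n$ with $F(X_j)=w_j$ for $j=1,2,3$ if and only if there are a rational inner function $H$ on $\mathbb{D}^n$, numbers $q_1,q_2$ and an index $l\in\{1,\dots,n\}$ such that 1. either $H(z)=z_j$ for some $j\in\{1,\dots,n\}$, or $H(z)=z^{\nu(Q)}\widetilde Q(1/z)/Q(z)$ for some irreducible polynomial $Q$ that has no zeros in $\mathbb{D}^n$ and is deficient in degree; 2. $q_j\in\overline{\mathbb{D}}$ and $q_jH(X_j')=w_j'$ for $j=1,2$ (thus $q_j=w_j'/H(X_j')$ if $H(X_j')\ne0$, whereas $H(X_j')=0$ is allowed only if $w_j'=0$, and $q_j$ may then be any point of $\overline{\mathbb{D}}$); 3. the $2\times2$ matrix $$M=\left[\frac{1-q_j\overline{q_k}}{1-X_{j,l}'\overline{X_{k,l}'}}\right]_{j,k=1}^2$$ is positive semidefinite. Furthermore, for all $H,q_1,q_2,l$ satisfying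 1–3: a) if $M=0$, then there is $c\in\partial\mathbb{D}$ such that $F=\psi_{w_3}^{-1}\circ(cH)\circ\Psi_{X_3}$ is a rational inner function with $F(X_j)=w_j$ for $j=1,2,3$; b) if $M$ has rank $r\in\{1,2\}$, then there is a Blaschke product $B$ of degree $r$ such that $F=\psi_{w_3}^{-1}\circ\big((B\circ\pi_l)H\big)\circ\Psi_{X_3}$ is a rational inner function with $F(X_j)=w_j$ for $j=1,2,3$, where $\pi_l$ is the projection onto the $l$-th coordinate. -/

import Mathlib

open Filter Topology MeasureTheory
open scoped ComplexOrder ComplexConjugate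

namespace PolydiscPick

/-- The open unit polydisc `𝔻ⁿ` in `ℂⁿ`. -/
def polydisc (n : ℕ) : Set (Fin n → ℂ) := {z | ∀ i, ‖z i‖ < 1}

/-- The disc automorphism `ψ_a(z) = (z - a) / (1 - conj a * z)`. -/
noncomputable def psi (a z : ℂ) : ℂ := (z - a) / (1 - conj a * z)

/-- The inverse automorphism `ψ_a⁻¹(z) = (z + a) / (1 + conj a * z)`;
see `psiInv_psi` and `psi_psiInv`. -/
noncomputable def psiInv (a z : ℂ) : ℂ := (z + a) / (1 + conj a * z)

/-- The automorphism `Ψ_A = (ψ_{A 1}, …, ψ_{A n})` of the polydisc. -/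
noncomputable def Psi {n : ℕ} (A z : Fin n → ℂ) : Fin n → ℂ := fun i => psi (A i) (z i)

/-- `f` is an inner function on `𝔻ⁿ`: it is a bounded holomorphic function on `𝔻ⁿ` and
`|f(r e^{iθ₁}, …, r e^{iθₙ})| → 1` as `r → 1⁻` for almost every point of the torus
(the torus being parametrized by the angles `θ`). -/
def IsInner {n : ℕ} (f : (Fin n → ℂ) → ℂ) : Prop :=
  DifferentiableOn ℂ f (polydisc n) ∧
  (∃ C : ℝ, ∀ z ∈ polydisc n, ‖f z‖ ≤ C) ∧
  ∀ᵐ θ : Fin n → ℝ,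
    Tendsto (fun r : ℝ => ‖f (fun i => (r : ℂ) * Complex.exp ((θ i : ℂ) * Complex.I))‖)
      (𝓝[<] 1) (𝓝 1)

/-- `f` is a rational inner function on `𝔻ⁿ`: it is inner, and on `𝔻ⁿ` it is the quotient of
two polynomials, the denominator having no zero in `𝔻ⁿ`. -/
def IsRationalInner {n : ℕ} (f : (Fin n → ℂ) → ℂ) : Prop :=
  IsInner f ∧
  ∃ P Q : MvPolynomial (Fin n) ℂ, ∀ z ∈ polydisc n,
    MvPolynomial.eval z Q ≠ 0 ∧ f z = MvPolynomial.eval z P / MvPolynomial.eval z Q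

/-- The multi-index `ν(Q)`, whose `j`-th entry is the degree of `Q` in the variable `z_j`. -/
noncomputable def nu {n : ℕ} (Q : MvPolynomial (Fin n) ℂ) : Fin n →₀ ℕ :=
  Finsupp.equivFunOnFinite.symm (fun j => Q.degreeOf j)

/-- `Q` is deficient in degree: the multi-index `ν(Q)` is not in the support of `Q`. -/
def DeficientInDegree {n : ℕ} (Q : MvPolynomial (Fin n) ℂ) : Prop := nu Q ∉ Q.support

/-- The polynomial `Q̃`, obtained from `Q` by conjugating its coefficients. -/
noncomputable def conjPoly {n : ℕ} (Q : MvPolynomial (Fin n) ℂ) : MvPolynomial (Fin n) ℂ :=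
  MvPolynomial.map (starRingEnd ℂ) Q

/-- The polynomial `z^{ν(Q)} Q̃(1/z) = ∑ conj(a_α) z^{ν(Q) - α}`, where `Q = ∑ a_α z^α`.
Here `α ≤ ν(Q)` for every `α` in the support, so that the subtraction is a genuine one;
see `eval_reflect`. -/
noncomputable def reflect {n : ℕ} (Q : MvPolynomial (Fin n) ℂ) : MvPolynomial (Fin n) ℂ :=
  ∑ α ∈ Q.support, MvPolynomial.monomial (nu Q - α) (conj (Q.coeff α))

/-- `H` has, on `𝔻ⁿ`, one of the two special forms: it is a coordinate function, or it is
`z^{ν(Q)} Q̃(1/z) / Q(z)` with `Q` irreducible, zero-free on `𝔻ⁿ` and deficient in degree. -/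
def HasSpecialForm {n : ℕ} (H : (Fin n → ℂ) → ℂ) : Prop :=
  (∃ j : Fin n, ∀ z ∈ polydisc n, H z = z j) ∨
  ∃ Q : MvPolynomial (Fin n) ℂ, Irreducible Q ∧ (∀ z ∈ polydisc n, MvPolynomial.eval z Q ≠ 0) ∧
    DeficientInDegree Q ∧
    ∀ z ∈ polydisc n, H z = MvPolynomial.eval z (reflect Q) / MvPolynomial.eval z Q

/-- The `2 × 2` Pick matrix `[(1 - q_j conj q_k) / (1 - x_j conj x_k)]`. -/
noncomputable def pickMatrix (x q : Fin 2 → ℂ) : Matrix (Fin 2) (Fin 2) ℂ :=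
  Matrix.of fun j k => (1 - q j * conj (q k)) / (1 - x j * conj (x k))

/-- `B` is, on the unit disc, a (finite) Blaschke product of degree `r`. -/
def IsBlaschkeProduct (r : ℕ) (B : ℂ → ℂ) : Prop :=
  ∃ (c : ℂ) (a : Fin r → ℂ), ‖c‖ = 1 ∧ (∀ i, ‖a i‖ < 1) ∧
    ∀ z : ℂ, ‖z‖ < 1 → B z = c * ∏ i, psi (a i) z

/-- `F` is a rational inner function on `𝔻ⁿ` with `F (X j) = w j` for the three indices `j`. -/
def IsInterpolant {n : ℕ} (X : Fin 3 → Fin n → ℂ) (w : Fin 3 → ℂ) (F : (Fin n → ℂ) → ℂ) : Prop :=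
  IsRationalInner F ∧ ∀ j, F (X j) = w j

/-- The transported nodes `X_j' = Ψ_{X_3}(X_j)`, `j = 1, 2`. -/
noncomputable def node {n : ℕ} (X : Fin 3 → Fin n → ℂ) (j : Fin 2) : Fin n → ℂ :=
  Psi (X 2) (X j.castSucc)

/-- The transported values `w_j' = ψ_{w_3}(w_j)`, `j = 1, 2`. -/
noncomputable def value (w : Fin 3 → ℂ) (j : Fin 2) : ℂ := psi (w 2) (w j.castSucc)

/-- The pair `q` is a pair of quotients `w_j' / H(X_j')` lying in the closed unit disc. If
`H(X_j') ≠ 0`, then `q j` is this quotient; if `H(X_j') = 0`, then `w_j'` has to be `0`, and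
`q j` is any number in the closed disc. -/
def IsQuotientPair {n : ℕ} (X : Fin 3 → Fin n → ℂ) (w : Fin 3 → ℂ) (H : (Fin n → ℂ) → ℂ)
    (q : Fin 2 → ℂ) : Prop :=
  ∀ j, ‖q j‖ ≤ 1 ∧ q j * H (node X j) = value w j

/-- The Pick matrix of the data with respect to the `l`-th coordinate. -/
noncomputable def dataMatrix {n : ℕ} (X : Fin 3 → Fin n → ℂ) (q : Fin 2 → ℂ) (l : Fin n) :
    Matrix (Fin 2) (Fin 2) ℂ :=
  pickMatrix (fun j => node X j l) q

theorem one_sub_conj_mul_ne {a z : ℂ} (ha : ‖a‖ < 1) (hz : ‖z‖ < 1) : 1 - conj a * z ≠ 0 := by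
  intro h
  have h1 : conj a * z = 1 := (sub_eq_zero.mp h).symm
  have h2 : ‖a‖ * ‖z‖ = 1 := by
    have := congrArg norm h1
    simpa using this
  nlinarith [norm_nonneg a, norm_nonneg z]

theorem one_add_conj_mul_ne {a z : ℂ} (ha : ‖a‖ < 1) (hz : ‖z‖ < 1) : 1 + conj a * z ≠ 0 := by
  have := one_sub_conj_mul_ne (a := -a) (z := z) (by simpa using ha) hz
  simpa using this

theorem psiInv_psi {a z : ℂ} (ha : ‖a‖ < 1) (hz : ‖z‖ < 1) : psiInv a (psi a z) = z := by
  have h1 := one_sub_conj_mul_ne ha hz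
  have h2 := one_sub_conj_mul_ne ha ha
  have h3 : 1 + conj a * psi a z = (1 - conj a * a) / (1 - conj a * z) := by
    unfold psi; field_simp; ring
  have h4 : psi a z + a = z * ((1 - conj a * a) / (1 - conj a * z)) := by
    rw [psi, div_add' _ _ _ h1, ← mul_div_assoc]; congr 1; ring
  rw [psiInv, h3, h4, mul_div_assoc, div_self (div_ne_zero h2 h1), mul_one]

theorem psi_psiInv {a z : ℂ} (ha : ‖a‖ < 1) (hz : ‖z‖ < 1) : psi a (psiInv a z) = z := by
  have h := psiInv_psi (a := -a) (z := z) (by simpa using ha) hz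
  simpa [psi, psiInv, sub_eq_add_neg] using h

theorem le_nu {n : ℕ} (Q : MvPolynomial (Fin n) ℂ) {α : Fin n →₀ ℕ} (h : α ∈ Q.support) :
    α ≤ nu Q := by
  intro j
  simpa [nu] using MvPolynomial.monomial_le_degreeOf j h

/-- Off the coordinate hyperplanes, `reflect Q` is `z^{ν(Q)} Q̃(1/z)`. -/
theorem eval_reflect {n : ℕ} (Q : MvPolynomial (Fin n) ℂ) (z : Fin n → ℂ) (hz : ∀ i, z i ≠ 0) :
    MvPolynomial.eval z (reflect Q) =
      (∏ i, z i ^ nu Q i) * MvPolynomial.eval (fun i => 1 / z i) (conjPoly Q) := by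
  have h : MvPolynomial.eval (fun i => 1 / z i) (conjPoly Q) =
      ∑ α ∈ Q.support, conj (Q.coeff α) * ∏ i, (1 / z i) ^ α i := by
    rw [conjPoly, MvPolynomial.eval_map, MvPolynomial.eval₂_eq']
  rw [h, reflect, map_sum, Finset.mul_sum]
  refine Finset.sum_congr rfl fun α hα => ?_
  rw [MvPolynomial.eval_monomial, Finsupp.prod_fintype _ _ (fun i => pow_zero _), mul_left_comm,
    ← Finset.prod_mul_distrib]
  congr 1
  refine Finset.prod_congr rfl fun i _ => ?_
  rw [Finsupp.tsub_apply, pow_sub₀ _ (hz i) (le_nu Q hα i), one_div, inv_pow]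

end PolydiscPick

/-!
A rational inner function is, on the polydisc, a quotient `P / Q` of polynomials such that `Q` has no
zero in `𝔻ⁿ` and `|P| = |Q|` on the torus; conversely every such quotient is rational inner
(`PolydiscPick.isRationalInner_iff`). The bound `|P / Q| ≤ 1` comes from the Mahler measure of the
restrictions to analytic discs, and the zeros of `Q` on the torus form a null set by Fubini. In this
form it is clear that rational inner functions are stable under products and under composition with
disc automorphisms on either side, so that the third node and the third value may be moved to `0`.

Let `G = P / Q` be the transported interpolant, with `G 0 = 0`. Some irreducible factor `p` of `P`
vanishes at `0`. On the torus `|P|² = |Q|²` is an identity between polynomials, namely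
`P * reflect P * z ^ ν(Q) = Q * reflect Q * z ^ ν(P)`. Since `Q 0 ≠ 0`, it follows that `p` is a
variable or, up to a constant, the reflection of an irreducible factor `Q₁` of `Q`; as `p 0 = 0`,
this `Q₁` is deficient in degree. Hence `G = K * H` with `H` of the special form and `K` rational
inner (`PolydiscPick.IsRationalInner.exists_special_factor`). The numbers `q j = K (X_j')` lie in the
closed disc, and by the Schwarz–Pick inequality on the polydisc
(`PolydiscPick.IsRationalInner.exists_norm_sub_mul_le`) their pseudohyperbolic distance is at most
that of the nodes in some coordinate `l`, which is the positivity of the Pick matrix.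

In the other direction the two-point Pick problem in the `l`-th coordinate is solved by a unimodular
constant or by a Blaschke product whose degree is the rank of the Pick matrix
(`PolydiscPick.exists_blaschke_one`, `PolydiscPick.exists_blaschke_two`). Its product with `H` takes
the right values at the first two nodes, and vanishes at `0` because `H` does.
-/

namespace PolydiscPick

/-! ### The disc automorphisms -/

theorem norm_sq_sub_norm_sq_psi (a z : ℂ) :
    ‖1 - conj a * z‖ ^ 2 - ‖z - a‖ ^ 2 = (1 - ‖a‖ ^ 2) * (1 - ‖z‖ ^ 2) := by
  simp only [Complex.sq_norm, Complex.normSq_apply, Complex.sub_re, Complex.sub_im, Complex.mul_re,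
    Complex.mul_im, Complex.conj_re, Complex.conj_im, Complex.one_re, Complex.one_im]
  ring

theorem one_sub_conj_mul_ne_of_le {a z : ℂ} (ha : ‖a‖ < 1) (hz : ‖z‖ ≤ 1) :
    1 - conj a * z ≠ 0 := by
  intro h
  have h2 : ‖a‖ * ‖z‖ = 1 := by
    simpa using congrArg norm (sub_eq_zero.mp h).symm
  nlinarith [norm_nonneg a, norm_nonneg z]

theorem norm_psi_lt_one {a z : ℂ} (ha : ‖a‖ < 1) (hz : ‖z‖ < 1) : ‖psi a z‖ < 1 := by
  have h := norm_pos_iff.mpr (one_sub_conj_mul_ne ha hz)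
  rw [psi, norm_div, div_lt_one h]
  have := norm_sq_sub_norm_sq_psi a z
  have h1 : 0 < (1 - ‖a‖ ^ 2) * (1 - ‖z‖ ^ 2) := by
    apply mul_pos <;> nlinarith [norm_nonneg a, norm_nonneg z]
  exact lt_of_pow_lt_pow_left₀ 2 h.le (by linarith)

theorem norm_psi_eq_one {a z : ℂ} (ha : ‖a‖ < 1) (hz : ‖z‖ = 1) : ‖psi a z‖ = 1 := by
  have h := norm_pos_iff.mpr (one_sub_conj_mul_ne_of_le ha hz.le)
  rw [psi, norm_div, div_eq_one_iff_eq h.ne']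
  have := norm_sq_sub_norm_sq_psi a z
  rw [hz] at this
  exact (pow_left_inj₀ (norm_nonneg _) h.le two_ne_zero).mp (by linarith)

theorem psiInv_eq_psi_neg (a z : ℂ) : psiInv a z = psi (-a) z := by
  simp [psi, psiInv]

theorem psi_self (a : ℂ) : psi a a = 0 := by simp [psi]

theorem psiInv_zero (a : ℂ) : psiInv a 0 = a := by simp [psiInv]

/-- The unit torus `𝕋ⁿ`. -/
def torus (n : ℕ) : Set (Fin n → ℂ) := {z | ∀ i, ‖z i‖ = 1}

theorem Psi_mem_polydisc {n : ℕ} {A z : Fin n → ℂ} (hA : A ∈ polydisc n) (hz : z ∈ polydisc n) :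
    Psi A z ∈ polydisc n := fun i => norm_psi_lt_one (hA i) (hz i)

theorem Psi_mem_torus {n : ℕ} {A z : Fin n → ℂ} (hA : A ∈ polydisc n) (hz : z ∈ torus n) :
    Psi A z ∈ torus n := fun i => norm_psi_eq_one (hA i) (hz i)

theorem neg_mem_polydisc {n : ℕ} {A : Fin n → ℂ} (hA : A ∈ polydisc n) : -A ∈ polydisc n :=
  fun i => by simpa using hA i

theorem zero_mem_polydisc (n : ℕ) : (0 : Fin n → ℂ) ∈ polydisc n := fun i => by simp

theorem Psi_neg_Psi {n : ℕ} {A z : Fin n → ℂ} (hA : A ∈ polydisc n) (hz : z ∈ polydisc n) :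
    Psi (-A) (Psi A z) = z := by
  funext i
  have := psiInv_psi (hA i) (hz i)
  rwa [psiInv_eq_psi_neg] at this

theorem Psi_neg_zero {n : ℕ} (A : Fin n → ℂ) : Psi (-A) 0 = A := by
  funext i
  simp [Psi, psi]

theorem Psi_self {n : ℕ} (A : Fin n → ℂ) : Psi A A = 0 := by
  funext i
  simp [Psi, psi]

/-- `P ∘ Ψ_A` becomes a polynomial after multiplication with a power of the product of the
denominators of the `ψ_{A i}`. The power may be chosen as large as one likes, so that the same one
serves for two polynomials. -/
theorem exists_eval_eq_pow_mul_eval_Psi {n : ℕ} (A : Fin n → ℂ) (P : MvPolynomial (Fin n) ℂ) :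
    ∃ N₀ : ℕ, ∀ N ≥ N₀, ∃ P' : MvPolynomial (Fin n) ℂ, ∀ z : Fin n → ℂ,
      (∀ i, 1 - conj (A i) * z i ≠ 0) →
      MvPolynomial.eval z P' =
        (∏ i, (1 - conj (A i) * z i)) ^ N * MvPolynomial.eval (Psi A z) P := by
  induction P using MvPolynomial.induction_on with
  | C a =>
    refine ⟨0, fun N _ => ⟨(∏ i, (1 - MvPolynomial.C (conj (A i)) * MvPolynomial.X i)) ^ N *
      MvPolynomial.C a, fun z _ => ?_⟩⟩
    simp [map_prod]
  | add p q hp hq =>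
    obtain ⟨N₁, h₁⟩ := hp
    obtain ⟨N₂, h₂⟩ := hq
    refine ⟨max N₁ N₂, fun N hN => ?_⟩
    obtain ⟨p', hp'⟩ := h₁ N (le_trans (le_max_left _ _) hN)
    obtain ⟨q', hq'⟩ := h₂ N (le_trans (le_max_right _ _) hN)
    refine ⟨p' + q', fun z hz => ?_⟩
    rw [map_add, map_add, hp' z hz, hq' z hz, mul_add]
  | mul_X p i hp =>
    obtain ⟨N₁, h₁⟩ := hp
    refine ⟨N₁ + 1, fun N hN => ?_⟩
    obtain ⟨M, rfl⟩ : ∃ M, N = M + 1 := ⟨N - 1, by omega⟩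
    obtain ⟨p', hp'⟩ := h₁ M (by omega)
    refine ⟨p' * ((∏ k ∈ Finset.univ.erase i,
      (1 - MvPolynomial.C (conj (A k)) * MvPolynomial.X k)) *
        (MvPolynomial.X i - MvPolynomial.C (A i))), fun z hz => ?_⟩
    have hprod := Finset.mul_prod_erase Finset.univ (fun k => 1 - conj (A k) * z k)
      (Finset.mem_univ i)
    have hi : z i - A i = (1 - conj (A i) * z i) * psi (A i) (z i) := by
      rw [psi, mul_div_cancel₀ _ (hz i)]
    simp only [map_mul, map_prod, map_sub, map_one, MvPolynomial.eval_C, MvPolynomial.eval_X,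
      hp' z hz, Psi]
    rw [pow_succ, ← hprod, hi]
    ring

/-! ### Pairs of polynomials with equal modulus on the torus -/

/-- The polynomial form of a rational inner function `P / Q`: the denominator has no zero on `𝔻ⁿ`,
and `|P| = |Q|` on all of `𝕋ⁿ` (common zeros on the torus are allowed). -/
structure IsInnerPair {n : ℕ} (P Q : MvPolynomial (Fin n) ℂ) : Prop where
  eval_ne_zero : ∀ z ∈ polydisc n, MvPolynomial.eval z Q ≠ 0
  norm_eq : ∀ z ∈ torus n, ‖MvPolynomial.eval z P‖ = ‖MvPolynomial.eval z Q‖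

theorem IsInnerPair.mul {n : ℕ} {P Q P' Q' : MvPolynomial (Fin n) ℂ} (h : IsInnerPair P Q)
    (h' : IsInnerPair P' Q') : IsInnerPair (P * P') (Q * Q') where
  eval_ne_zero z hz := by
    rw [map_mul]
    exact mul_ne_zero (h.eval_ne_zero z hz) (h'.eval_ne_zero z hz)
  norm_eq z hz := by rw [map_mul, map_mul, norm_mul, norm_mul, h.norm_eq z hz, h'.norm_eq z hz]

theorem IsInnerPair.comp_Psi {n : ℕ} {P Q : MvPolynomial (Fin n) ℂ} (h : IsInnerPair P Q)
    {A : Fin n → ℂ} (hA : A ∈ polydisc n) :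
    ∃ P' Q' : MvPolynomial (Fin n) ℂ, IsInnerPair P' Q' ∧ ∀ z ∈ polydisc n, ∃ d : ℂ, d ≠ 0 ∧
      MvPolynomial.eval z P' = d * MvPolynomial.eval (Psi A z) P ∧
      MvPolynomial.eval z Q' = d * MvPolynomial.eval (Psi A z) Q := by
  obtain ⟨N₁, h₁⟩ := exists_eval_eq_pow_mul_eval_Psi A P
  obtain ⟨N₂, h₂⟩ := exists_eval_eq_pow_mul_eval_Psi A Q
  obtain ⟨P', hP'⟩ := h₁ (max N₁ N₂) (le_max_left _ _)
  obtain ⟨Q', hQ'⟩ := h₂ (max N₁ N₂) (le_max_right _ _)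
  have hD : ∀ z ∈ polydisc n, ∀ i, 1 - conj (A i) * z i ≠ 0 := fun z hz i =>
    one_sub_conj_mul_ne (hA i) (hz i)
  have hT : ∀ z ∈ torus n, ∀ i, 1 - conj (A i) * z i ≠ 0 := fun z hz i =>
    one_sub_conj_mul_ne_of_le (hA i) (hz i).le
  have hd : ∀ z ∈ polydisc n, (∏ i, (1 - conj (A i) * z i)) ^ (max N₁ N₂) ≠ 0 := fun z hz =>
    pow_ne_zero _ (Finset.prod_ne_zero_iff.mpr fun i _ => hD z hz i)
  refine ⟨P', Q', ⟨fun z hz => ?_, fun z hz => ?_⟩, fun z hz =>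
    ⟨_, hd z hz, hP' z (hD z hz), hQ' z (hD z hz)⟩⟩
  · rw [hQ' z (hD z hz)]
    exact mul_ne_zero (hd z hz) (h.eval_ne_zero _ (Psi_mem_polydisc hA hz))
  · rw [hP' z (hT z hz), hQ' z (hT z hz), norm_mul, norm_mul,
      h.norm_eq _ (Psi_mem_torus hA hz)]

theorem _root_.Polynomial.norm_eval_zero_eq (p : Polynomial ℂ) :
    ‖p.eval 0‖ = ‖p.leadingCoeff‖ * (p.roots.map fun a => ‖a‖).prod := by
  rw [(IsAlgClosed.splits p).eval_eq_prod_roots, norm_mul]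
  congr 1
  have := map_multiset_prod (normHom (α := ℂ)) (p.roots.map fun a => 0 - a)
  simpa [Multiset.map_map, Function.comp_def] using this

/-- Both sides are compared with the Mahler measure, which only depends on the moduli on the unit
circle, bounds the modulus at `0` from above, and equals it when no root lies in the disc. -/
theorem _root_.Polynomial.norm_eval_zero_le_of_norm_eq {p q : Polynomial ℂ}
    (hq : ∀ z : ℂ, ‖z‖ < 1 → q.eval z ≠ 0)
    (h : ∀ z : ℂ, ‖z‖ = 1 → ‖p.eval z‖ = ‖q.eval z‖) : ‖p.eval 0‖ ≤ ‖q.eval 0‖ := by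
  have hq0 : q ≠ 0 := by
    rintro rfl
    simpa using hq 0 (by simp)
  by_cases hp0 : p = 0
  · simp [hp0]
  have hM : p.mahlerMeasure = q.mahlerMeasure := by
    rw [Polynomial.mahlerMeasure, Polynomial.mahlerMeasure, if_pos hp0, if_pos hq0,
      Polynomial.logMahlerMeasure, Polynomial.logMahlerMeasure]
    congr 1
    apply Real.circleAverage_congr_sphere
    intro z hz
    simp only
    rw [h z (by simpa using hz)]
  calc ‖p.eval 0‖ ≤ p.mahlerMeasure := by
        rw [p.norm_eval_zero_eq, Polynomial.mahlerMeasure_eq_leadingCoeff_mul_prod_roots]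
        gcongr
        exact Multiset.prod_map_le_prod_map₀ _ _ (fun _ _ => norm_nonneg _)
          (fun _ _ => le_max_right _ _)
    _ = q.mahlerMeasure := hM
    _ = ‖q.eval 0‖ := by
        rw [q.norm_eval_zero_eq, Polynomial.mahlerMeasure_eq_leadingCoeff_mul_prod_roots]
        congr 2
        refine Multiset.map_congr rfl fun a ha => max_eq_right ?_
        by_contra hlt
        exact hq a (not_le.mp hlt) (Polynomial.isRoot_of_mem_roots ha)

theorem eval_aeval {n : ℕ} (g : Fin n → Polynomial ℂ) (R : MvPolynomial (Fin n) ℂ) (t : ℂ) :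
    (MvPolynomial.aeval g R).eval t = MvPolynomial.eval (fun i => (g i).eval t) R := by
  induction R using MvPolynomial.induction_on with
  | C a => simp
  | add p q hp hq => simp [hp, hq]
  | mul_X p i hp => simp [hp]

/-- The maximum principle for inner pairs. The value at `0` is treated on the diagonal of `𝔻ⁿ`,
and `Ψ_{-z}` moves `0` to an arbitrary point `z`. -/
theorem IsInnerPair.norm_eval_le {n : ℕ} {P Q : MvPolynomial (Fin n) ℂ} (h : IsInnerPair P Q)
    {z : Fin n → ℂ} (hz : z ∈ polydisc n) :
    ‖MvPolynomial.eval z P‖ ≤ ‖MvPolynomial.eval z Q‖ := by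
  obtain ⟨P', Q', h', hd⟩ := h.comp_Psi (neg_mem_polydisc hz)
  obtain ⟨d, hd0, hP, hQ⟩ := hd 0 (zero_mem_polydisc n)
  rw [Psi_neg_zero] at hP hQ
  have hdiag : ∀ (R : MvPolynomial (Fin n) ℂ) (t : ℂ),
      (MvPolynomial.aeval (fun _ => (Polynomial.X : Polynomial ℂ)) R).eval t =
        MvPolynomial.eval (fun _ => t) R := fun R t => by simp [eval_aeval]
  have key := Polynomial.norm_eval_zero_le_of_norm_eq
    (p := MvPolynomial.aeval (fun _ => (Polynomial.X : Polynomial ℂ)) P')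
    (q := MvPolynomial.aeval (fun _ => (Polynomial.X : Polynomial ℂ)) Q')
    (fun t ht => by rw [hdiag]; exact h'.eval_ne_zero _ fun _ => ht)
    (fun t ht => by rw [hdiag, hdiag]; exact h'.norm_eq _ fun _ => ht)
  rw [hdiag, hdiag] at key
  change ‖MvPolynomial.eval 0 P'‖ ≤ ‖MvPolynomial.eval 0 Q'‖ at key
  rw [hP, hQ, norm_mul, norm_mul] at key
  exact le_of_mul_le_mul_left key (norm_pos_iff.mpr hd0)

/-- The point of the torus with the angles `θ`. -/
noncomputable def torusPoint {n : ℕ} (θ : Fin n → ℝ) : Fin n → ℂ :=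
  fun i => Complex.exp ((θ i : ℂ) * Complex.I)

theorem torusPoint_mem {n : ℕ} (θ : Fin n → ℝ) : torusPoint θ ∈ torus n :=
  fun i => Complex.norm_exp_ofReal_mul_I (θ i)

theorem continuous_torusPoint (n : ℕ) : Continuous (torusPoint : (Fin n → ℝ) → _) := by
  unfold torusPoint
  fun_prop

theorem exists_torusPoint_eq {n : ℕ} {z : Fin n → ℂ} (hz : z ∈ torus n) :
    ∃ θ, torusPoint θ = z := by
  refine ⟨fun i => (z i).arg, ?_⟩
  funext i
  have := Complex.norm_mul_exp_arg_mul_I (z i)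
  rw [hz i] at this
  simpa [torusPoint] using this

/-- A polynomial that does not vanish at `0` has only finitely many zeros on each circle
`{t ζ : |t| = 1}`, hence by Fubini a null set of zeros on the torus. -/
theorem ae_eval_torusPoint_ne_zero {n : ℕ} {Q : MvPolynomial (Fin n) ℂ}
    (hQ : MvPolynomial.eval 0 Q ≠ 0) :
    ∀ᵐ θ : Fin n → ℝ, MvPolynomial.eval (torusPoint θ) Q ≠ 0 := by
  have hcirc : ∀ θ : Fin n → ℝ, ∀ᵐ t : ℝ,
      MvPolynomial.eval (torusPoint (θ + fun _ => t)) Q ≠ 0 := by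
    intro θ
    set q : Polynomial ℂ := MvPolynomial.aeval
      (fun i => Polynomial.C (torusPoint θ i) * Polynomial.X) Q with hq
    have hev : ∀ t : ℂ, q.eval t = MvPolynomial.eval (fun i => torusPoint θ i * t) Q := by
      intro t
      simp [hq, eval_aeval]
    have hq0 : q ≠ 0 := by
      intro h0
      have := hev 0
      rw [h0] at this
      simp only [Polynomial.eval_zero, mul_zero] at this
      exact hQ this.symm
    have hc : ((q.roots.toFinset : Set ℂ)).Countable := (Finset.finite_toSet _).countable
    have hn := (hc.preimage_circleMap 0 one_ne_zero).measure_zero volume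
    rw [measure_eq_zero_iff_ae_notMem] at hn
    filter_upwards [hn] with t ht h0
    apply ht
    simp only [Set.mem_preimage, Finset.mem_coe, Multiset.mem_toFinset, Polynomial.mem_roots hq0,
      Polynomial.IsRoot.def, hev]
    convert h0 using 3
    funext i
    simp [torusPoint, circleMap, add_mul, Complex.exp_add]
  have hcont : Continuous fun x : (Fin n → ℝ) × ℝ =>
      MvPolynomial.eval (torusPoint (x.1 + fun _ => x.2)) Q := by
    refine (MvPolynomial.continuous_eval Q).comp ((continuous_torusPoint n).comp ?_)
    fun_prop
  have hae := (Measure.ae_ae_comm (μ := (volume : Measure (Fin n → ℝ)))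
    (ν := (volume : Measure ℝ))
    (p := fun θ t => MvPolynomial.eval (torusPoint (θ + fun _ => t)) Q ≠ 0)
    (isOpen_ne.preimage hcont).measurableSet).mp (ae_of_all _ hcirc)
  obtain ⟨t, ht⟩ := hae.exists
  have := (measurePreserving_add_right (volume : Measure (Fin n → ℝ))
    (fun _ => -t)).quasiMeasurePreserving.ae ht
  filter_upwards [this] with θ hθ
  convert hθ using 4
  funext i
  simp

/-! ### Rational inner functions -/

/-- For the forward direction the radial limit `|f| → 1` gives `|P| = |Q|` almost everywhere on the
torus, without knowing that `Q` is nonzero there, and continuity gives it everywhere. -/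
theorem isRationalInner_iff {n : ℕ} {f : (Fin n → ℂ) → ℂ} :
    IsRationalInner f ↔ ∃ P Q : MvPolynomial (Fin n) ℂ, IsInnerPair P Q ∧
      ∀ z ∈ polydisc n, f z = MvPolynomial.eval z P / MvPolynomial.eval z Q := by
  have hin : ∀ (θ : Fin n → ℝ) {r : ℝ}, r ∈ Set.Ioo (0 : ℝ) 1 →
      (fun i => (r : ℂ) * torusPoint θ i) ∈ polydisc n := by
    intro θ r hr i
    rw [norm_mul, torusPoint_mem θ i, mul_one, Complex.norm_real, Real.norm_of_nonneg hr.1.le]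
    exact hr.2
  have hmem : Set.Ioo (0 : ℝ) 1 ∈ 𝓝[<] (1 : ℝ) := Ioo_mem_nhdsLT one_pos
  have hlim : ∀ (R : MvPolynomial (Fin n) ℂ) (θ : Fin n → ℝ),
      Tendsto (fun r : ℝ => ‖MvPolynomial.eval (fun i => (r : ℂ) * torusPoint θ i) R‖)
        (𝓝[<] 1) (𝓝 ‖MvPolynomial.eval (torusPoint θ) R‖) := by
    intro R θ
    have hc : Continuous fun r : ℝ =>
        ‖MvPolynomial.eval (fun i => (r : ℂ) * torusPoint θ i) R‖ :=
      ((MvPolynomial.continuous_eval R).comp (by fun_prop)).norm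
    have := hc.tendsto 1
    simp only [Complex.ofReal_one, one_mul] at this
    exact this.mono_left nhdsWithin_le_nhds
  constructor
  · rintro ⟨⟨-, -, hrad⟩, P, Q, hPQ⟩
    refine ⟨P, Q, ⟨fun z hz => (hPQ z hz).1, ?_⟩, fun z hz => (hPQ z hz).2⟩
    have hae : (fun θ : Fin n → ℝ => ‖MvPolynomial.eval (torusPoint θ) P‖) =ᵐ[volume]
        fun θ => ‖MvPolynomial.eval (torusPoint θ) Q‖ := by
      filter_upwards [hrad] with θ hθ
      have h1 := hθ.mul (hlim Q θ)
      rw [one_mul] at h1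
      refine tendsto_nhds_unique (hlim P θ) (h1.congr' ?_)
      filter_upwards [hmem] with r hr
      obtain ⟨hQ, hf⟩ := hPQ _ (hin θ hr)
      change ‖f (fun i => (r : ℂ) * torusPoint θ i)‖ * _ = _
      rw [hf, norm_div, div_mul_cancel₀ _ (norm_ne_zero_iff.mpr hQ)]
    have hcont : ∀ R : MvPolynomial (Fin n) ℂ,
        Continuous fun θ : Fin n → ℝ => ‖MvPolynomial.eval (torusPoint θ) R‖ := fun R =>
      ((MvPolynomial.continuous_eval R).comp (continuous_torusPoint n)).norm
    have heq := ((hcont P).ae_eq_iff_eq volume (hcont Q)).mp hae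
    intro z hz
    obtain ⟨θ, rfl⟩ := exists_torusPoint_eq hz
    exact congrFun heq θ
  · rintro ⟨P, Q, h, hf⟩
    have hdiff : ∀ R : MvPolynomial (Fin n) ℂ,
        DifferentiableOn ℂ (fun z => MvPolynomial.eval z R) (polydisc n) := fun R =>
      (AnalyticOnNhd.eval_mvPolynomial R).differentiableOn.mono (Set.subset_univ _)
    refine ⟨⟨((hdiff P).mul ((hdiff Q).inv h.eval_ne_zero)).congr fun z hz => (hf z hz).trans
      (div_eq_mul_inv _ _), ⟨1, fun z hz => ?_⟩, ?_⟩,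
      P, Q, fun z hz => ⟨h.eval_ne_zero z hz, hf z hz⟩⟩
    · rw [hf z hz, norm_div]
      exact div_le_one_of_le₀ (h.norm_eval_le hz) (norm_nonneg _)
    · filter_upwards [ae_eval_torusPoint_ne_zero (h.eval_ne_zero 0 (zero_mem_polydisc n))]
        with θ hθ
      have h1 := (hlim P θ).div (hlim Q θ) (norm_ne_zero_iff.mpr hθ)
      rw [h.norm_eq _ (torusPoint_mem θ), div_self (norm_ne_zero_iff.mpr hθ)] at h1
      refine h1.congr' ?_
      filter_upwards [hmem] with r hr
      have := hf _ (hin θ hr)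
      change _ = ‖f (fun i => (r : ℂ) * torusPoint θ i)‖
      rw [this, norm_div]
      rfl

namespace IsRationalInner

variable {n : ℕ} {f g : (Fin n → ℂ) → ℂ}

theorem norm_le_one (hf : IsRationalInner f) {z : Fin n → ℂ} (hz : z ∈ polydisc n) :
    ‖f z‖ ≤ 1 := by
  obtain ⟨P, Q, h, hPQ⟩ := isRationalInner_iff.mp hf
  rw [hPQ z hz, norm_div]
  exact div_le_one_of_le₀ (h.norm_eval_le hz) (norm_nonneg _)

theorem congr (hf : IsRationalInner f) (h : ∀ z ∈ polydisc n, g z = f z) :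
    IsRationalInner g := by
  obtain ⟨P, Q, hi, hPQ⟩ := isRationalInner_iff.mp hf
  exact isRationalInner_iff.mpr ⟨P, Q, hi, fun z hz => (h z hz).trans (hPQ z hz)⟩

theorem const {c : ℂ} (hc : ‖c‖ = 1) : IsRationalInner fun _ : Fin n → ℂ => c :=
  isRationalInner_iff.mpr ⟨MvPolynomial.C c, 1, ⟨by simp, by simp [hc]⟩, by simp⟩

theorem coord (l : Fin n) : IsRationalInner fun z : Fin n → ℂ => z l :=
  isRationalInner_iff.mpr ⟨MvPolynomial.X l, 1, ⟨by simp, fun z hz => by simp [hz l]⟩, by simp⟩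

theorem mul (hf : IsRationalInner f) (hg : IsRationalInner g) :
    IsRationalInner fun z => f z * g z := by
  obtain ⟨P, Q, h, hPQ⟩ := isRationalInner_iff.mp hf
  obtain ⟨P', Q', h', hPQ'⟩ := isRationalInner_iff.mp hg
  refine isRationalInner_iff.mpr ⟨P * P', Q * Q', h.mul h', fun z hz => ?_⟩
  rw [hPQ z hz, hPQ' z hz, map_mul, map_mul, div_mul_div_comm]

theorem comp_Psi (hf : IsRationalInner f) {A : Fin n → ℂ} (hA : A ∈ polydisc n) :
    IsRationalInner fun z => f (Psi A z) := by
  obtain ⟨P, Q, h, hPQ⟩ := isRationalInner_iff.mp hf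
  obtain ⟨P', Q', h', hd⟩ := h.comp_Psi hA
  refine isRationalInner_iff.mpr ⟨P', Q', h', fun z hz => ?_⟩
  obtain ⟨d, hd0, hP, hQ⟩ := hd z hz
  rw [hPQ _ (Psi_mem_polydisc hA hz), hP, hQ, mul_div_mul_left _ _ hd0]

theorem psi_comp (hf : IsRationalInner f) {a : ℂ} (ha : ‖a‖ < 1) :
    IsRationalInner fun z => psi a (f z) := by
  obtain ⟨P, Q, h, hPQ⟩ := isRationalInner_iff.mp hf
  have hne : ∀ z ∈ polydisc n,
      1 - conj a * (MvPolynomial.eval z P / MvPolynomial.eval z Q) ≠ 0 := fun z hz => by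
    rw [← hPQ z hz]
    exact one_sub_conj_mul_ne_of_le ha (hf.norm_le_one hz)
  have hfac : ∀ z ∈ polydisc n, MvPolynomial.eval z Q - conj a * MvPolynomial.eval z P =
      MvPolynomial.eval z Q * (1 - conj a * (MvPolynomial.eval z P / MvPolynomial.eval z Q)) := by
    intro z hz
    have := h.eval_ne_zero z hz
    field_simp
  refine isRationalInner_iff.mpr ⟨P - MvPolynomial.C a * Q, Q - MvPolynomial.C (conj a) * P,
    ⟨fun z hz => ?_, fun z hz => ?_⟩, fun z hz => ?_⟩
  · simp only [map_sub, map_mul, MvPolynomial.eval_C]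
    rw [hfac z hz]
    exact mul_ne_zero (h.eval_ne_zero z hz) (hne z hz)
  · simp only [map_sub, map_mul, MvPolynomial.eval_C]
    have hn := h.norm_eq z hz
    have : ∀ p q : ℂ, ‖q - conj a * p‖ ^ 2 - ‖p - a * q‖ ^ 2 =
        (1 - ‖a‖ ^ 2) * (‖q‖ ^ 2 - ‖p‖ ^ 2) := by
      intro p q
      simp only [Complex.sq_norm, Complex.normSq_apply, Complex.sub_re, Complex.sub_im,
        Complex.mul_re, Complex.mul_im, Complex.conj_re, Complex.conj_im]
      ring
    have hs := this (MvPolynomial.eval z P) (MvPolynomial.eval z Q)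
    rw [hn, sub_self, mul_zero] at hs
    exact (pow_left_inj₀ (norm_nonneg _) (norm_nonneg _) two_ne_zero).mp (by linarith)
  · simp only [map_sub, map_mul, MvPolynomial.eval_C]
    have hq := h.eval_ne_zero z hz
    rw [hPQ z hz, psi, hfac z hz, div_sub' hq, div_div, mul_comm a]

theorem psiInv_comp (hf : IsRationalInner f) {a : ℂ} (ha : ‖a‖ < 1) :
    IsRationalInner fun z => psiInv a (f z) := by
  simp only [psiInv_eq_psi_neg]
  exact hf.psi_comp (by simpa using ha)

theorem blaschke_coord {r : ℕ} {B : ℂ → ℂ} (hB : IsBlaschkeProduct r B) (l : Fin n) :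
    IsRationalInner fun z : Fin n → ℂ => B (z l) := by
  obtain ⟨c, a, hc, ha, hB⟩ := hB
  have hprod : ∀ s : Finset (Fin r),
      IsRationalInner fun z : Fin n → ℂ => ∏ i ∈ s, psi (a i) (z l) := by
    intro s
    induction s using Finset.induction_on with
    | empty => simpa using const (n := n) (c := 1) (by simp)
    | insert i s hi ih =>
      refine (((coord l).psi_comp (ha i)).mul ih).congr fun z _ => ?_
      rw [Finset.prod_insert hi]
  exact ((const hc).mul (hprod Finset.univ)).congr fun z hz => hB _ (hz l)

end IsRationalInner

/-! ### The Schwarz–Pick inequality -/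

theorem norm_sub_le_of_mapsTo_closedBall {h : ℂ → ℂ}
    (hd : DifferentiableOn ℂ h (Metric.ball 0 1))
    (hm : Set.MapsTo h (Metric.ball 0 1) (Metric.closedBall 0 1)) {z : ℂ} (hz : ‖z‖ < 1) :
    ‖h z - h 0‖ ≤ ‖z‖ * ‖1 - conj (h 0) * h z‖ := by
  have hle : ∀ t : ℂ, ‖t‖ < 1 → ‖h t‖ ≤ 1 := fun t ht => by
    simpa using hm (show t ∈ Metric.ball (0 : ℂ) 1 by simpa using ht)
  rcases (hle 0 (by simp)).lt_or_eq with h0 | h0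
  · have hne : ∀ t : ℂ, ‖t‖ < 1 → 1 - conj (h 0) * h t ≠ 0 := fun t ht =>
      one_sub_conj_mul_ne_of_le h0 (hle t ht)
    have key := Complex.norm_le_norm_of_mapsTo_ball (f := fun t => psi (h 0) (h t)) (R := 1)
      ((hd.sub_const _).div ((hd.const_mul _).const_sub _) fun t ht => hne t (by simpa using ht))
      (fun t ht => by
        have ht' : ‖t‖ < 1 := by simpa using ht
        rcases (hle t ht').lt_or_eq with h1 | h1
        · simpa using (norm_psi_lt_one h0 h1).le
        · simpa using (norm_psi_eq_one h0 h1).le)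
      (psi_self _) hz
    rwa [psi, norm_div, div_le_iff₀ (norm_pos_iff.mpr (hne z hz))] at key
  · have hmax : IsMaxOn (norm ∘ h) (Metric.ball 0 1) 0 := fun t ht => by
      simpa [h0] using hle t (by simpa using ht)
    have := Complex.eqOn_of_isPreconnected_of_isMaxOn_norm
      (convex_ball (0 : ℂ) 1).isPreconnected Metric.isOpen_ball hd (Metric.mem_ball_self one_pos)
      hmax (show z ∈ Metric.ball (0 : ℂ) 1 by simpa using hz)
    rw [this]
    simpa using by positivity

/-- The Schwarz–Pick inequality on the polydisc: `l` is a coordinate in which the pseudohyperbolic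
distance of the two points is largest, and the one-variable inequality is applied on a disc through
the two points whose other coordinates are controlled by the `l`-th one. -/
theorem IsRationalInner.exists_norm_sub_mul_le {n : ℕ} [Nonempty (Fin n)] {K : (Fin n → ℂ) → ℂ}
    (hK : IsRationalInner K) {x y : Fin n → ℂ} (hx : x ∈ polydisc n) (hy : y ∈ polydisc n) :
    ∃ l, ‖K x - K y‖ * ‖1 - conj (y l) * x l‖ ≤ ‖x l - y l‖ * ‖1 - conj (K y) * K x‖ := by
  obtain ⟨l, -, hl⟩ := Finset.exists_max_image Finset.univ (fun i => ‖Psi y x i‖)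
    Finset.univ_nonempty
  refine ⟨l, ?_⟩
  have hD := norm_pos_iff.mpr (one_sub_conj_mul_ne (hy l) (hx l))
  have hback : Psi (-y) (Psi y x) = x := Psi_neg_Psi hy hx
  set u := Psi y x with hu
  have hρ : ‖u l‖ = ‖x l - y l‖ / ‖1 - conj (y l) * x l‖ := by rw [hu, Psi, psi, norm_div]
  suffices hs : ‖K x - K y‖ ≤ ‖u l‖ * ‖1 - conj (K y) * K x‖ by
    rw [hρ, div_mul_eq_mul_div, le_div_iff₀ hD] at hs
    exact hs
  by_cases h0 : ‖u l‖ = 0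
  · have hu0 : u = 0 := by
      funext i
      have := hl i (Finset.mem_univ i)
      rw [h0] at this
      exact norm_le_zero_iff.mp this
    rw [hu0, Psi_neg_zero] at hback
    have hK0 : K x - K y = 0 := by rw [hback, sub_self]
    rw [hK0, norm_zero]
    positivity
  have hpos : 0 < ‖u l‖ := lt_of_le_of_ne (norm_nonneg _) (Ne.symm h0)
  have hlt : ‖u l‖ < 1 := Psi_mem_polydisc hy hx l
  have hρC : ((‖u l‖ : ℝ) : ℂ) ≠ 0 := by exact_mod_cast h0
  have hG := hK.comp_Psi (neg_mem_polydisc hy)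
  have hmaps : ∀ t ∈ Metric.ball (0 : ℂ) 1, (fun i => t * (u i / (‖u l‖ : ℝ))) ∈ polydisc n := by
    intro t ht i
    have ht' : ‖t‖ < 1 := by simpa using ht
    rw [norm_mul, norm_div, Complex.norm_real, norm_norm]
    have : ‖u i‖ / ‖u l‖ ≤ 1 := div_le_one_of_le₀ (hl i (Finset.mem_univ i)) hpos.le
    nlinarith [norm_nonneg t, div_nonneg (norm_nonneg (u i)) hpos.le]
  have key := norm_sub_le_of_mapsTo_closedBall
    (h := fun t => K (Psi (-y) fun i => t * (u i / (‖u l‖ : ℝ))))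
    (hG.1.1.comp (f := fun (t : ℂ) (i : Fin n) => t * (u i / (‖u l‖ : ℝ)))
      (by fun_prop) hmaps)
    (fun t ht => by simpa using hG.norm_le_one (hmaps t ht))
    (z := (‖u l‖ : ℝ)) (by simpa using hlt)
  have h1 : (fun i => ((‖u l‖ : ℝ) : ℂ) * (u i / (‖u l‖ : ℝ))) = u := by
    funext i
    rw [mul_div_cancel₀ _ hρC]
  have h2 : (fun i => (0 : ℂ) * (u i / (‖u l‖ : ℝ))) = 0 := by
    funext i
    simp
  simp only [h1, h2, hback, Psi_neg_zero, Complex.norm_real, norm_norm] at key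
  exact key

/-! ### Reflection of polynomials -/

section Reflect

variable {n : ℕ}

theorem eq_of_eval_eq_on_torus {P Q : MvPolynomial (Fin n) ℂ}
    (h : ∀ z ∈ torus n, MvPolynomial.eval z P = MvPolynomial.eval z Q) : P = Q := by
  have hinf : (Metric.sphere (0 : ℂ) 1).Infinite := by
    refine (isPreconnected_sphere (by simp [Complex.rank_real_complex]) (0 : ℂ)
      1).infinite_of_nontrivial ⟨1, by simp, -1, by simp, ?_⟩
    norm_num
  refine MvPolynomial.funext_set (fun _ => Metric.sphere (0 : ℂ) 1) (fun _ => hinf) fun z hz => ?_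
  exact h z fun i => by simpa using hz i (Set.mem_univ i)

theorem nu_apply (Q : MvPolynomial (Fin n) ℂ) (j : Fin n) : nu Q j = Q.degreeOf j := rfl

theorem nu_mul {P Q : MvPolynomial (Fin n) ℂ} (hP : P ≠ 0) (hQ : Q ≠ 0) :
    nu (P * Q) = nu P + nu Q := by
  ext j
  simp only [Finsupp.add_apply, nu_apply, MvPolynomial.degreeOf_mul_eq hP hQ]

theorem eval_monomial_eq (z : Fin n → ℂ) (m : Fin n →₀ ℕ) (c : ℂ) :
    MvPolynomial.eval z (MvPolynomial.monomial m c) = c * ∏ i, z i ^ m i := by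
  rw [MvPolynomial.eval_monomial, Finsupp.prod_fintype _ _ fun i => pow_zero _]

theorem prod_pow_mul_conj {z : Fin n → ℂ} (hz : z ∈ torus n) (m : Fin n →₀ ℕ) :
    (∏ i, z i ^ m i) * conj (∏ i, z i ^ m i) = 1 := by
  rw [Complex.mul_conj, Complex.normSq_eq_norm_sq, norm_prod]
  simp [hz _]

theorem eval_reflect_of_mem_torus (Q : MvPolynomial (Fin n) ℂ) {z : Fin n → ℂ}
    (hz : z ∈ torus n) :
    MvPolynomial.eval z (reflect Q) = (∏ i, z i ^ nu Q i) * conj (MvPolynomial.eval z Q) := by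
  have hz0 : ∀ i, z i ≠ 0 := fun i h => by simpa [h] using hz i
  have hinv : (fun i => 1 / z i) = fun i => conj (z i) := by
    funext i
    rw [one_div, Complex.inv_def, Complex.normSq_eq_norm_sq, hz i]
    simp
  have hconj : ∀ R : MvPolynomial (Fin n) ℂ,
      MvPolynomial.eval (fun i => conj (z i)) (MvPolynomial.map (starRingEnd ℂ) R) =
        conj (MvPolynomial.eval z R) := by
    intro R
    induction R using MvPolynomial.induction_on with
    | C a => simp
    | add p q hp hq => simp [hp, hq]
    | mul_X p i hp => simp [hp]
  rw [eval_reflect Q z hz0, hinv, conjPoly, hconj]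

theorem norm_eval_reflect (Q : MvPolynomial (Fin n) ℂ) {z : Fin n → ℂ} (hz : z ∈ torus n) :
    ‖MvPolynomial.eval z (reflect Q)‖ = ‖MvPolynomial.eval z Q‖ := by
  rw [eval_reflect_of_mem_torus Q hz, norm_mul, norm_prod]
  simp [hz _]

theorem isInnerPair_reflect {Q : MvPolynomial (Fin n) ℂ}
    (hQ : ∀ z ∈ polydisc n, MvPolynomial.eval z Q ≠ 0) : IsInnerPair (reflect Q) Q :=
  ⟨hQ, fun _ hz => norm_eval_reflect Q hz⟩

theorem coeff_reflect (Q : MvPolynomial (Fin n) ℂ) {α : Fin n →₀ ℕ} (hα : α ≤ nu Q) :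
    (reflect Q).coeff (nu Q - α) = conj (Q.coeff α) := by
  classical
  rw [reflect, MvPolynomial.coeff_sum, Finset.sum_eq_single α]
  · rw [MvPolynomial.coeff_monomial, if_pos rfl]
  · intro β hβ hne
    rw [MvPolynomial.coeff_monomial, if_neg]
    intro h
    apply hne
    ext i
    have h1 := DFunLike.congr_fun h i
    have h2 := le_nu Q hβ i
    have h3 := hα i
    simp only [Finsupp.tsub_apply] at h1
    omega
  · intro h
    rw [MvPolynomial.coeff_monomial, if_pos rfl, MvPolynomial.notMem_support_iff.mp h, map_zero]

theorem eval_zero_reflect (Q : MvPolynomial (Fin n) ℂ) :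
    MvPolynomial.eval 0 (reflect Q) = conj (Q.coeff (nu Q)) := by
  rw [← coeff_reflect Q le_rfl, tsub_self, ← MvPolynomial.constantCoeff_eq]
  simp

theorem deficientInDegree_iff {Q : MvPolynomial (Fin n) ℂ} :
    DeficientInDegree Q ↔ MvPolynomial.eval 0 (reflect Q) = 0 := by
  rw [eval_zero_reflect, DeficientInDegree, MvPolynomial.notMem_support_iff, map_eq_zero]

theorem not_X_dvd_reflect {Q : MvPolynomial (Fin n) ℂ} (hQ : Q ≠ 0) (j : Fin n) :
    ¬ MvPolynomial.X j ∣ reflect Q := by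
  classical
  rintro ⟨R, hR⟩
  obtain ⟨α, hα, hαj⟩ := Finset.exists_mem_eq_sup Q.support
    (MvPolynomial.support_nonempty.mpr hQ) (fun m => m j)
  rw [← MvPolynomial.degreeOf_eq_sup] at hαj
  have h := coeff_reflect Q (le_nu Q hα)
  rw [hR, MvPolynomial.coeff_X_mul', if_neg] at h
  · exact MvPolynomial.mem_support_iff.mp hα ((map_eq_zero _).mp h.symm)
  · simp [Finsupp.mem_support_iff, nu_apply, hαj]

theorem nu_reflect_le (Q : MvPolynomial (Fin n) ℂ) : nu (reflect Q) ≤ nu Q := by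
  classical
  intro j
  rw [nu_apply, MvPolynomial.degreeOf_le_iff]
  intro m hm
  rw [reflect] at hm
  obtain ⟨α, -, hα⟩ := Finset.mem_biUnion.mp (MvPolynomial.support_sum hm)
  have := MvPolynomial.support_monomial_subset hα
  rw [Finset.mem_singleton] at this
  rw [this, Finsupp.tsub_apply]
  exact Nat.sub_le _ _

theorem reflect_mul {P Q : MvPolynomial (Fin n) ℂ} (hP : P ≠ 0) (hQ : Q ≠ 0) :
    reflect (P * Q) = reflect P * reflect Q := by
  refine eq_of_eval_eq_on_torus fun z hz => ?_
  rw [map_mul, eval_reflect_of_mem_torus _ hz, eval_reflect_of_mem_torus _ hz,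
    eval_reflect_of_mem_torus _ hz, nu_mul hP hQ, map_mul, map_mul]
  simp only [Finsupp.add_apply, pow_add, Finset.prod_mul_distrib]
  ring

theorem reflect_reflect_mul_monomial (Q : MvPolynomial (Fin n) ℂ) :
    reflect (reflect Q) * MvPolynomial.monomial (nu Q - nu (reflect Q)) 1 = Q := by
  refine eq_of_eval_eq_on_torus fun z hz => ?_
  rw [map_mul, eval_reflect_of_mem_torus _ hz, eval_reflect_of_mem_torus _ hz, eval_monomial_eq,
    map_mul, Complex.conj_conj]
  have h : (∏ i, z i ^ nu (reflect Q) i) * ∏ i, z i ^ (nu Q - nu (reflect Q)) i =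
      ∏ i, z i ^ nu Q i := by
    rw [← Finset.prod_mul_distrib]
    refine Finset.prod_congr rfl fun i _ => ?_
    rw [← pow_add, Finsupp.tsub_apply, Nat.add_sub_cancel' (nu_reflect_le Q i)]
  linear_combination (conj (∏ i, z i ^ nu Q i) * MvPolynomial.eval z Q) * h +
    MvPolynomial.eval z Q * prod_pow_mul_conj hz (nu Q)

theorem reflect_ne_zero {Q : MvPolynomial (Fin n) ℂ} (hQ : Q ≠ 0) : reflect Q ≠ 0 := by
  intro h
  apply hQ
  rw [← reflect_reflect_mul_monomial Q, h]
  simp [reflect]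

theorem eq_monomial_of_isUnit_reflect {Q : MvPolynomial (Fin n) ℂ} (h : IsUnit (reflect Q)) :
    ∃ c : ℂ, c ≠ 0 ∧ Q = MvPolynomial.monomial (nu Q) c := by
  obtain ⟨c, hc, hQ⟩ := MvPolynomial.isUnit_iff_eq_C_of_isReduced.mp h
  refine ⟨conj c, (map_ne_zero _).mpr hc.ne_zero, eq_of_eval_eq_on_torus fun z hz => ?_⟩
  have h1 := eval_reflect_of_mem_torus Q hz
  rw [hQ, MvPolynomial.eval_C] at h1
  rw [eval_monomial_eq, h1, map_mul, Complex.conj_conj]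
  linear_combination -MvPolynomial.eval z Q * prod_pow_mul_conj hz (nu Q)

/-- The reflection of an irreducible polynomial is, up to associates, irreducible: a factorization
of `reflect Q` reflects back to one of `Q`, so one factor is a monomial, and `reflect Q` is not
divisible by any variable. -/
theorem reflect_dvd_of_dvd_reflect {p Q : MvPolynomial (Fin n) ℂ} (hQ : Irreducible Q)
    (hp : Irreducible p) (hpX : ∀ j, ¬ MvPolynomial.X j ∣ p) (hpQ : p ∣ reflect Q) :
    reflect Q ∣ p := by
  obtain ⟨s, hs⟩ := hpQ
  have hR0 := reflect_ne_zero hQ.ne_zero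
  have hs0 : s ≠ 0 := by
    rintro rfl
    exact hR0 (by rw [hs, mul_zero])
  have hfac := reflect_reflect_mul_monomial Q
  rw [hs, reflect_mul hp.ne_zero hs0, mul_assoc] at hfac
  rcases hQ.isUnit_or_isUnit hfac.symm with hu | hu
  · obtain ⟨c, hc, hpc⟩ := eq_monomial_of_isUnit_reflect hu
    by_cases hν : nu p = 0
    · refine absurd ?_ hp.not_isUnit
      rw [hpc, hν]
      exact (isUnit_iff_ne_zero.mpr hc).map MvPolynomial.C
    · obtain ⟨j, hj⟩ := Finsupp.ne_iff.mp hν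
      refine absurd ?_ (hpX j)
      rw [hpc, MvPolynomial.X_dvd_monomial]
      exact Or.inr hj
  · obtain ⟨c, hc, hsc⟩ := eq_monomial_of_isUnit_reflect (isUnit_of_mul_isUnit_left hu)
    have hν : nu s = 0 := by
      by_contra hν
      obtain ⟨j, hj⟩ := Finsupp.ne_iff.mp hν
      refine not_X_dvd_reflect hQ.ne_zero j (Dvd.dvd.trans ?_ ⟨p, hs.trans (mul_comm _ _)⟩)
      rw [hsc, MvPolynomial.X_dvd_monomial]
      exact Or.inr hj
    have hsu : IsUnit s := by
      rw [hsc, hν]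
      exact (isUnit_iff_ne_zero.mpr hc).map MvPolynomial.C
    rw [hs]
    exact hsu.mul_right_dvd.mpr dvd_rfl

theorem exists_irreducible_dvd_of_dvd_reflect {p : MvPolynomial (Fin n) ℂ} (hp : Prime p)
    {Q : MvPolynomial (Fin n) ℂ} (hQ : Q ≠ 0) (h : p ∣ reflect Q) :
    ∃ q, Irreducible q ∧ q ∣ Q ∧ p ∣ reflect q := by
  induction Q using WfDvdMonoid.induction_on_irreducible with
  | zero => exact absurd rfl hQ
  | unit u hu =>
    obtain ⟨c, hc, rfl⟩ := MvPolynomial.isUnit_iff_eq_C_of_isReduced.mp hu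
    refine absurd (isUnit_of_dvd_unit h ?_) hp.not_isUnit
    have : reflect (MvPolynomial.C c : MvPolynomial (Fin n) ℂ) = MvPolynomial.C (conj c) := by
      refine eq_of_eval_eq_on_torus fun z hz => ?_
      simp [eval_reflect_of_mem_torus _ hz, nu_apply]
    rw [this]
    exact (isUnit_iff_ne_zero.mpr ((map_ne_zero _).mpr hc.ne_zero)).map MvPolynomial.C
  | mul a i ha hi ih =>
    rw [reflect_mul hi.ne_zero ha] at h
    rcases hp.dvd_or_dvd h with h | h
    · exact ⟨i, hi, dvd_mul_right _ _, h⟩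
    · obtain ⟨q, hq, hqa, hpq⟩ := ih ha h
      exact ⟨q, hq, hqa.mul_left _, hpq⟩

end Reflect

/-! ### Splitting off a special factor -/

/-- The factor `S` may vanish on the torus, but only on a null set, so that continuity gives
`|P| = |Q|` there too. -/
theorem IsInnerPair.of_mul_left {n : ℕ} {R S P Q : MvPolynomial (Fin n) ℂ}
    (h : IsInnerPair (R * P) (S * Q)) (hRS : IsInnerPair R S) : IsInnerPair P Q := by
  have hcont : ∀ T : MvPolynomial (Fin n) ℂ,
      Continuous fun θ : Fin n → ℝ => ‖MvPolynomial.eval (torusPoint θ) T‖ := fun T =>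
    ((MvPolynomial.continuous_eval T).comp (continuous_torusPoint n)).norm
  refine ⟨fun z hz => ?_, fun z hz => ?_⟩
  · have := h.eval_ne_zero z hz
    rw [map_mul] at this
    exact right_ne_zero_of_mul this
  · have hae : (fun θ : Fin n → ℝ => ‖MvPolynomial.eval (torusPoint θ) P‖) =ᵐ[volume]
        fun θ => ‖MvPolynomial.eval (torusPoint θ) Q‖ := by
      filter_upwards [ae_eval_torusPoint_ne_zero (hRS.eval_ne_zero 0 (zero_mem_polydisc n))]
        with θ hθ
      have h1 := h.norm_eq _ (torusPoint_mem θ)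
      rw [map_mul, map_mul, norm_mul, norm_mul, hRS.norm_eq _ (torusPoint_mem θ)] at h1
      exact mul_left_cancel₀ (norm_ne_zero_iff.mpr hθ) h1
    have heq := ((hcont P).ae_eq_iff_eq volume (hcont Q)).mp hae
    obtain ⟨θ, rfl⟩ := exists_torusPoint_eq hz
    exact congrFun heq θ

/-- On the torus this is `P * conj P = Q * conj Q`, cleared of negative exponents. -/
theorem IsInnerPair.mul_reflect_eq {n : ℕ} {P Q : MvPolynomial (Fin n) ℂ} (h : IsInnerPair P Q) :
    P * reflect P * MvPolynomial.monomial (nu Q) 1 =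
      Q * reflect Q * MvPolynomial.monomial (nu P) 1 := by
  refine eq_of_eval_eq_on_torus fun z hz => ?_
  have hn : MvPolynomial.eval z P * conj (MvPolynomial.eval z P) =
      MvPolynomial.eval z Q * conj (MvPolynomial.eval z Q) := by
    rw [Complex.mul_conj, Complex.mul_conj, Complex.normSq_eq_norm_sq, Complex.normSq_eq_norm_sq,
      h.norm_eq z hz]
  simp only [map_mul, eval_reflect_of_mem_torus _ hz, eval_monomial_eq]
  linear_combination ((∏ i, z i ^ nu P i) * ∏ i, z i ^ nu Q i) * hn

/-- An inner pair whose numerator vanishes at `0` has a special factor vanishing at `0`: some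
irreducible factor `p` of `P` vanishes at `0`, and by `IsInnerPair.mul_reflect_eq` it divides a
variable or the reflection of an irreducible factor of `Q`. -/
theorem IsInnerPair.exists_special_factor {n : ℕ} {P Q : MvPolynomial (Fin n) ℂ}
    (h : IsInnerPair P Q) (h0 : MvPolynomial.eval 0 P = 0) :
    ∃ R S, IsInnerPair R S ∧ R ∣ P ∧ S ∣ Q ∧
      HasSpecialForm fun z => MvPolynomial.eval z R / MvPolynomial.eval z S := by
  by_cases hX : ∃ j, MvPolynomial.X j ∣ P
  · obtain ⟨j, hj⟩ := hX
    exact ⟨MvPolynomial.X j, 1, ⟨by simp, fun z hz => by simp [hz j]⟩, hj, one_dvd _,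
      Or.inl ⟨j, by simp⟩⟩
  push Not at hX
  have hQ0 := h.eval_ne_zero 0 (zero_mem_polydisc n)
  have hQ : Q ≠ 0 := by
    rintro rfl
    simp at hQ0
  have hP : P ≠ 0 := by
    rintro rfl
    refine hQ (eq_of_eval_eq_on_torus fun z hz => ?_)
    have := h.norm_eq z hz
    rw [map_zero, norm_zero] at this
    rw [map_zero, norm_eq_zero.mp this.symm]
  obtain ⟨p, hp, hpP, hp0⟩ : ∃ p, Prime p ∧ p ∣ P ∧ MvPolynomial.eval 0 p = 0 := by
    obtain ⟨f, hf, hfP⟩ := UniqueFactorizationMonoid.exists_prime_factors P hP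
    obtain ⟨u, hu⟩ := hfP.dvd'
    have hz : MvPolynomial.eval 0 f.prod = 0 := by rw [hu, map_mul, h0, zero_mul]
    rw [map_multiset_prod, Multiset.prod_eq_zero_iff, Multiset.mem_map] at hz
    obtain ⟨p, hpf, hp0⟩ := hz
    exact ⟨p, hf p hpf, (Multiset.dvd_prod hpf).trans hfP.dvd, hp0⟩
  have hpX : ∀ j, ¬ MvPolynomial.X j ∣ p := fun j hj => hX j (hj.trans hpP)
  have hdvd : p ∣ Q * reflect Q * MvPolynomial.monomial (nu P) 1 := by
    rw [← h.mul_reflect_eq, mul_assoc]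
    exact hpP.mul_right _
  have hpr : p ∣ reflect Q := by
    rcases hp.dvd_or_dvd hdvd with hd | hd
    · rcases hp.dvd_or_dvd hd with hd | hd
      · obtain ⟨s, rfl⟩ := hd
        exact absurd (by rw [map_mul, hp0, zero_mul]) hQ0
      · exact hd
    · rw [MvPolynomial.monomial_eq, map_one, one_mul, Finsupp.prod] at hd
      obtain ⟨j, -, hj⟩ := hp.exists_mem_finset_dvd hd
      have hj := hp.dvd_of_dvd_pow hj
      exact absurd ((hp.irreducible.associated_of_dvd
        MvPolynomial.X_prime.irreducible hj).dvd') (hpX j)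
  obtain ⟨q, hq, hqQ, hpq⟩ := exists_irreducible_dvd_of_dvd_reflect hp hQ hpr
  have hqz : ∀ z ∈ polydisc n, MvPolynomial.eval z q ≠ 0 := by
    intro z hz hqz
    obtain ⟨s, rfl⟩ := hqQ
    exact h.eval_ne_zero z hz (by rw [map_mul, hqz, zero_mul])
  refine ⟨reflect q, q, isInnerPair_reflect hqz,
    (reflect_dvd_of_dvd_reflect hq hp.irreducible hpX hpq).trans hpP, hqQ,
    Or.inr ⟨q, hq, hqz, ?_, fun _ _ => rfl⟩⟩
  rw [deficientInDegree_iff]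
  obtain ⟨s, hs⟩ := hpq
  rw [hs, map_mul, hp0, zero_mul]

theorem IsRationalInner.exists_special_factor {n : ℕ} {G : (Fin n → ℂ) → ℂ}
    (hG : IsRationalInner G) (hG0 : G 0 = 0) :
    ∃ H K, IsRationalInner H ∧ HasSpecialForm H ∧ IsRationalInner K ∧
      ∀ z ∈ polydisc n, K z * H z = G z := by
  obtain ⟨P, Q, h, hPQ⟩ := isRationalInner_iff.mp hG
  have h0 : MvPolynomial.eval 0 P = 0 := by
    have := hPQ 0 (zero_mem_polydisc n)
    rw [hG0, eq_comm, div_eq_zero_iff] at this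
    exact this.resolve_right (h.eval_ne_zero 0 (zero_mem_polydisc n))
  obtain ⟨R, S, hRS, ⟨P', rfl⟩, ⟨Q', rfl⟩, hsp⟩ := h.exists_special_factor h0
  refine ⟨_, fun z => MvPolynomial.eval z P' / MvPolynomial.eval z Q',
    isRationalInner_iff.mpr ⟨R, S, hRS, fun _ _ => rfl⟩, hsp,
    isRationalInner_iff.mpr ⟨P', Q', h.of_mul_left hRS, fun _ _ => rfl⟩, fun z hz => ?_⟩
  rw [hPQ z hz, map_mul, map_mul, mul_comm, mul_div_mul_comm]

theorem HasSpecialForm.apply_zero {n : ℕ} {H : (Fin n → ℂ) → ℂ} (hH : HasSpecialForm H) :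
    H 0 = 0 := by
  rcases hH with ⟨j, hj⟩ | ⟨Q, -, -, hdef, hH⟩
  · exact hj 0 (zero_mem_polydisc n)
  · rw [hH 0 (zero_mem_polydisc n), deficientInDegree_iff.mp hdef, zero_div]

/-! ### Blaschke products -/

theorem IsBlaschkeProduct.const_mul_psi {c a : ℂ} (hc : ‖c‖ = 1) (ha : ‖a‖ < 1) :
    IsBlaschkeProduct 1 fun z => c * psi a z :=
  ⟨c, fun _ => a, hc, fun _ => ha, fun z _ => by simp⟩

theorem IsBlaschkeProduct.psi_mul {r : ℕ} {B : ℂ → ℂ} (hB : IsBlaschkeProduct r B) {a : ℂ}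
    (ha : ‖a‖ < 1) : IsBlaschkeProduct (r + 1) fun z => psi a z * B z := by
  obtain ⟨c, b, hc, hb, hB⟩ := hB
  refine ⟨c, Fin.cons a b, hc, fun i => ?_, fun z hz => ?_⟩
  · refine Fin.cases ?_ (fun i => ?_) i
    · simpa using ha
    · simpa using hb i
  · simp only [hB z hz, Fin.prod_univ_succ, Fin.cons_zero, Fin.cons_succ]
    ring

theorem norm_one_sub_conj_mul_le {a z : ℂ} (ha : ‖a‖ < 1) (hz : 1 ≤ ‖z‖) :
    ‖1 - conj a * z‖ ≤ ‖z - a‖ := by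
  refine le_of_pow_le_pow_left₀ two_ne_zero (norm_nonneg _) ?_
  have := norm_sq_sub_norm_sq_psi a z
  nlinarith [mul_nonneg (by nlinarith [norm_nonneg a] : (0 : ℝ) ≤ 1 - ‖a‖ ^ 2)
    (by nlinarith : (0 : ℝ) ≤ ‖z‖ ^ 2 - 1)]

theorem exists_eq_map_of_card_eq {α : Type*} (m : Multiset α) {r : ℕ}
    (h : Multiset.card m = r) : ∃ f : Fin r → α, m = Finset.univ.val.map f := by
  obtain ⟨l, rfl⟩ := Quot.exists_rep m
  obtain rfl : l.length = r := h
  refine ⟨l.get, ?_⟩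
  rw [Fin.univ_val_map, List.ofFn_get]
  rfl

/-- With `p = ∏ (z - a i)` and `s = ∏ (1 - conj (a i) * z)`, the composition is
`(c * p + b * s) / (s + conj b * c * p)`. Up to a constant the denominator is the reflection of the
numerator, whose `r` roots lie in the disc because `|s| ≤ |p|` outside of it. -/
theorem IsBlaschkeProduct.psiInv_comp {r : ℕ} {B : ℂ → ℂ} (hB : IsBlaschkeProduct r B) {b : ℂ}
    (hb : ‖b‖ < 1) : IsBlaschkeProduct r fun z => psiInv b (B z) := by
  obtain ⟨c, a, hc, ha, hB⟩ := hB
  have hcc : c * conj c = 1 := by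
    rw [Complex.mul_conj, Complex.normSq_eq_norm_sq, hc]
    simp
  set p : Polynomial ℂ := ∏ i, (Polynomial.X - Polynomial.C (a i)) with hp
  set s : Polynomial ℂ := ∏ i, (1 - Polynomial.C (conj (a i)) * Polynomial.X) with hs
  have hpe : ∀ z, p.eval z = ∏ i, (z - a i) := fun z => by simp [hp, Polynomial.eval_prod]
  have hse : ∀ z, s.eval z = ∏ i, (1 - conj (a i) * z) := fun z => by
    simp [hs, Polynomial.eval_prod]
  set N : Polynomial ℂ := Polynomial.C c * p + Polynomial.C b * s with hN
  set L : ℂ := c + b * ∏ i, -conj (a i) with hL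
  have hpc : p.coeff r = 1 := by
    have := Polynomial.coeff_prod_of_natDegree_le (s := Finset.univ)
      (fun i => Polynomial.X - Polynomial.C (a i)) 1 (fun i _ => by compute_degree)
    simpa [Polynomial.coeff_C] using this
  have hsc : s.coeff r = ∏ i, -conj (a i) := by
    have := Polynomial.coeff_prod_of_natDegree_le (s := Finset.univ)
      (fun i => 1 - Polynomial.C (conj (a i)) * Polynomial.X) 1 (fun i _ => by compute_degree)
    simpa [Polynomial.coeff_one] using this
  have hpd : p.natDegree ≤ r := by
    refine (Polynomial.natDegree_prod_le _ _).trans ?_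
    refine (Finset.sum_le_card_nsmul _ _ 1 fun i _ => by compute_degree).trans ?_
    simp
  have hsd : s.natDegree ≤ r := by
    refine (Polynomial.natDegree_prod_le _ _).trans ?_
    refine (Finset.sum_le_card_nsmul _ _ 1 fun i _ => by compute_degree).trans ?_
    simp
  have hNc : N.coeff r = L := by simp [hN, hL, hpc, hsc]
  have hNd : N.natDegree ≤ r := by
    refine (Polynomial.natDegree_add_le _ _).trans (max_le ?_ ?_)
    · exact (Polynomial.natDegree_C_mul_le _ _).trans hpd
    · exact (Polynomial.natDegree_C_mul_le _ _).trans hsd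
  have hL0 : L ≠ 0 := by
    intro h0
    have h1 : ‖b * ∏ i, -conj (a i)‖ = 1 := by
      rw [← hc, ← norm_neg c]
      congr 1
      linear_combination h0
    have h2 : ‖∏ i, -conj (a i)‖ ≤ 1 := by
      rw [norm_prod]
      exact Finset.prod_le_one (fun _ _ => norm_nonneg _) fun i _ => by simpa using (ha i).le
    rw [norm_mul] at h1
    nlinarith [norm_nonneg b]
  have hdeg : N.natDegree = r :=
    le_antisymm hNd (Polynomial.le_natDegree_of_ne_zero (by rwa [hNc]))
  have hlead : N.leadingCoeff = L := by rw [Polynomial.leadingCoeff, hdeg, hNc]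
  obtain ⟨ρ, hρ⟩ := exists_eq_map_of_card_eq N.roots
    ((IsAlgClosed.splits N).natDegree_eq_card_roots.symm.trans hdeg)
  have hNe : ∀ z, N.eval z = L * ∏ i, (z - ρ i) := by
    intro z
    rw [(IsAlgClosed.splits N).eval_eq_prod_roots, hlead, hρ, Multiset.map_map]
    rfl
  have hNe' : ∀ z, N.eval z = c * p.eval z + b * s.eval z := fun z => by simp [hN]
  have hρ1 : ∀ i, ‖ρ i‖ < 1 := by
    intro i
    by_contra hge
    rw [not_lt] at hge
    have h0 : c * p.eval (ρ i) + b * s.eval (ρ i) = 0 := by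
      rw [← hNe', hNe, Finset.prod_eq_zero (Finset.mem_univ i) (sub_self _), mul_zero]
    have h1 : ‖p.eval (ρ i)‖ = ‖b‖ * ‖s.eval (ρ i)‖ := by
      rw [← norm_mul, ← norm_neg (b * _), ← one_mul ‖p.eval (ρ i)‖, ← hc, ← norm_mul]
      congr 1
      linear_combination h0
    have h2 : ‖s.eval (ρ i)‖ ≤ ‖p.eval (ρ i)‖ := by
      rw [hse, hpe, norm_prod, norm_prod]
      exact Finset.prod_le_prod (fun _ _ => norm_nonneg _) fun k _ =>
        norm_one_sub_conj_mul_le (ha k) hge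
    have h3 : 0 < ‖p.eval (ρ i)‖ := by
      rw [norm_pos_iff, hpe, Finset.prod_ne_zero_iff]
      intro k _ hk
      rw [sub_eq_zero.mp hk] at hge
      exact absurd (ha k) (not_lt.mpr hge)
    nlinarith [norm_nonneg b, norm_nonneg (s.eval (ρ i))]
  have hden : ∀ z, s.eval z + conj b * (c * p.eval z) =
      c * conj L * ∏ i, (1 - conj (ρ i) * z) := by
    intro z
    rcases eq_or_ne z 0 with rfl | hz
    · simp only [hse, hpe, hL, mul_zero, sub_zero, Finset.prod_const_one, zero_sub, mul_one,
        map_add, map_mul, map_prod, map_neg, Complex.conj_conj]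
      linear_combination -hcc
    · have hrefl : ∀ f : Fin r → ℂ, z ^ r * conj (∏ i, (conj z⁻¹ - f i)) =
          ∏ i, (1 - conj (f i) * z) := by
        intro f
        have : z ^ r = ∏ _i : Fin r, z := by simp
        rw [this, map_prod, ← Finset.prod_mul_distrib]
        refine Finset.prod_congr rfl fun i _ => ?_
        rw [map_sub, Complex.conj_conj]
        field_simp
      have hs' : z ^ r * conj (s.eval (conj z⁻¹)) = p.eval z := by
        have : z ^ r = ∏ _i : Fin r, z := by simp
        rw [hse, hpe, this, map_prod, ← Finset.prod_mul_distrib]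
        refine Finset.prod_congr rfl fun i _ => ?_
        rw [map_sub, map_mul, Complex.conj_conj, Complex.conj_conj, map_one]
        field_simp
      have hp' : z ^ r * conj (p.eval (conj z⁻¹)) = s.eval z := by rw [hpe, hse, hrefl]
      have hN' := congrArg (fun t => z ^ r * conj t) ((hNe (conj z⁻¹)).symm.trans (hNe' _))
      simp only [map_add, map_mul] at hN'
      rw [← hrefl ρ]
      linear_combination (-c) * hN' - conj b * c * hs' - c * conj c * hp' - s.eval z * hcc
  refine ⟨L / (c * conj L), ρ, ?_, hρ1, fun z hz => ?_⟩
  · rw [norm_div, norm_mul, hc, one_mul, Complex.norm_conj, div_self (norm_ne_zero_iff.mpr hL0)]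
  · have hsz : s.eval z ≠ 0 := by
      rw [hse, Finset.prod_ne_zero_iff]
      exact fun i _ => one_sub_conj_mul_ne (ha i) hz
    have hBz : B z = c * p.eval z / s.eval z := by
      rw [hB z hz, hpe, hse, mul_div_assoc, ← Finset.prod_div_distrib]
      rfl
    have h1 : psiInv b (B z) = N.eval z / (s.eval z + conj b * (c * p.eval z)) := by
      rw [psiInv, hBz, hNe', ← mul_div_mul_left _ _ hsz]
      congr 1 <;> field_simp
    refine h1.trans ?_
    rw [hNe, hden, mul_div_mul_comm, ← Finset.prod_div_distrib]
    rfl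

/-! ### The `2 × 2` Pick matrix -/

section Pick

variable {x q : Fin 2 → ℂ}

theorem pickMatrix_apply_self (j : Fin 2) :
    pickMatrix x q j j = (((1 - ‖q j‖ ^ 2) / (1 - ‖x j‖ ^ 2) : ℝ) : ℂ) := by
  simp [pickMatrix, Complex.mul_conj, Complex.normSq_eq_norm_sq]

theorem conj_pickMatrix (j k : Fin 2) : conj (pickMatrix x q j k) = pickMatrix x q k j := by
  simp [pickMatrix, mul_comm]

theorem isHermitian_pickMatrix : (pickMatrix x q).IsHermitian := by
  ext j k
  exact conj_pickMatrix k j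

theorem det_pickMatrix_eq_sub :
    (pickMatrix x q).det = (((1 - ‖q 0‖ ^ 2) / (1 - ‖x 0‖ ^ 2) * ((1 - ‖q 1‖ ^ 2) /
      (1 - ‖x 1‖ ^ 2)) - ‖pickMatrix x q 0 1‖ ^ 2 : ℝ) : ℂ) := by
  rw [Matrix.det_fin_two, pickMatrix_apply_self, pickMatrix_apply_self, ← conj_pickMatrix 0 1,
    Complex.mul_conj, Complex.normSq_eq_norm_sq, Complex.ofReal_sub, Complex.ofReal_mul]

theorem one_sub_norm_sq_pos {a : ℂ} (ha : ‖a‖ < 1) : 0 < 1 - ‖a‖ ^ 2 := by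
  nlinarith [norm_nonneg a]

theorem norm_one_sub_mul_conj (a b : ℂ) : ‖1 - a * conj b‖ = ‖1 - conj b * a‖ := by
  rw [mul_comm]

/-- The determinant compares the pseudohyperbolic distance of the values with that of the
nodes. -/
theorem det_pickMatrix (hx : ∀ j, ‖x j‖ < 1) :
    (pickMatrix x q).det = (((‖x 0 - x 1‖ ^ 2 * ‖1 - conj (q 1) * q 0‖ ^ 2 -
      ‖q 0 - q 1‖ ^ 2 * ‖1 - conj (x 1) * x 0‖ ^ 2) / ((1 - ‖x 0‖ ^ 2) * (1 - ‖x 1‖ ^ 2) *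
        ‖1 - conj (x 1) * x 0‖ ^ 2) : ℝ) : ℂ) := by
  rw [det_pickMatrix_eq_sub]
  congr 1
  have h0 := (one_sub_norm_sq_pos (hx 0)).ne'
  have h1 := (one_sub_norm_sq_pos (hx 1)).ne'
  have hD := norm_ne_zero_iff.mpr (one_sub_conj_mul_ne (hx 1) (hx 0))
  have hxx := norm_sq_sub_norm_sq_psi (x 1) (x 0)
  have hqq := norm_sq_sub_norm_sq_psi (q 1) (q 0)
  have hoff : ‖pickMatrix x q 0 1‖ ^ 2 =
      ‖1 - conj (q 1) * q 0‖ ^ 2 / ‖1 - conj (x 1) * x 0‖ ^ 2 := by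
    rw [pickMatrix, Matrix.of_apply, norm_div, norm_one_sub_mul_conj, norm_one_sub_mul_conj,
      div_pow]
  rw [hoff, div_mul_div_comm, div_sub_div _ _ (mul_ne_zero h0 h1) (pow_ne_zero 2 hD)]
  congr 1
  linear_combination (-‖1 - conj (x 1) * x 0‖ ^ 2) * hqq + ‖1 - conj (q 1) * q 0‖ ^ 2 * hxx

theorem det_pickMatrix_denom_pos (hx : ∀ j, ‖x j‖ < 1) :
    0 < (1 - ‖x 0‖ ^ 2) * (1 - ‖x 1‖ ^ 2) * ‖1 - conj (x 1) * x 0‖ ^ 2 :=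
  mul_pos (mul_pos (one_sub_norm_sq_pos (hx 0)) (one_sub_norm_sq_pos (hx 1)))
    (pow_pos (norm_pos_iff.mpr (one_sub_conj_mul_ne (hx 1) (hx 0))) 2)

theorem posSemidef_pickMatrix (hx : ∀ j, ‖x j‖ < 1) (hq : ∀ j, ‖q j‖ ≤ 1)
    (h : ‖q 0 - q 1‖ * ‖1 - conj (x 1) * x 0‖ ≤ ‖x 0 - x 1‖ * ‖1 - conj (q 1) * q 0‖) :
    (pickMatrix x q).PosSemidef := by
  have hH := isHermitian_pickMatrix (x := x) (q := q)
  have hdet := hH.det_eq_prod_eigenvalues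
  have htr := hH.trace_eq_sum_eigenvalues
  rw [det_pickMatrix hx, Fin.prod_univ_two] at hdet
  rw [Matrix.trace_fin_two, pickMatrix_apply_self, pickMatrix_apply_self, Fin.sum_univ_two] at htr
  have hdet' := Complex.ofReal_injective (hdet.trans (Complex.ofReal_mul _ _).symm)
  have htr' := Complex.ofReal_injective
    ((Complex.ofReal_add _ _).trans (htr.trans (Complex.ofReal_add _ _).symm))
  have hprod : 0 ≤ hH.eigenvalues 0 * hH.eigenvalues 1 := by
    refine (div_nonneg ?_ (det_pickMatrix_denom_pos hx).le).trans_eq hdet'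
    have := pow_le_pow_left₀ (by positivity) h 2
    rw [mul_pow, mul_pow] at this
    linarith
  have hsum : 0 ≤ hH.eigenvalues 0 + hH.eigenvalues 1 := by
    have : ∀ j, 0 ≤ (1 - ‖q j‖ ^ 2) / (1 - ‖x j‖ ^ 2) := fun j =>
      div_nonneg (by nlinarith [hq j, norm_nonneg (q j)]) (one_sub_norm_sq_pos (hx j)).le
    exact (add_nonneg (this 0) (this 1)).trans_eq htr'
  rw [hH.posSemidef_iff_eigenvalues_nonneg]
  intro i
  fin_cases i
  · change 0 ≤ hH.eigenvalues 0
    nlinarith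
  · change 0 ≤ hH.eigenvalues 1
    nlinarith

theorem norm_eq_one_of_pickMatrix_eq_zero (hx : ∀ j, ‖x j‖ < 1) (h : pickMatrix x q = 0) :
    ‖q 0‖ = 1 ∧ q 0 = q 1 := by
  have hn : ∀ j, ‖q j‖ = 1 := by
    intro j
    have h0 := pickMatrix_apply_self (x := x) (q := q) j
    rw [h, Matrix.zero_apply, eq_comm, Complex.ofReal_eq_zero, div_eq_zero_iff] at h0
    have := h0.resolve_right (one_sub_norm_sq_pos (hx j)).ne'
    exact (pow_eq_one_iff_of_nonneg (norm_nonneg _) two_ne_zero).mp (by linarith)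
  have h01 : pickMatrix x q 0 1 = 0 := by rw [h, Matrix.zero_apply]
  rw [pickMatrix, Matrix.of_apply, div_eq_zero_iff] at h01
  have hq := h01.resolve_right (by
    rw [mul_comm]
    exact one_sub_conj_mul_ne (hx 1) (hx 0))
  have h1 : q 1 * conj (q 1) = 1 := by
    rw [Complex.mul_conj, Complex.normSq_eq_norm_sq, hn 1]
    simp
  exact ⟨hn 0, by linear_combination (-q 0) * h1 - q 1 * hq⟩

/-- A unimodular value would make the product of the diagonal entries vanish, hence also the
off-diagonal entries, which forces both values to be unimodular. -/
theorem norm_lt_one_of_pickMatrix_ne_zero (hx : ∀ j, ‖x j‖ < 1) (hq : ∀ j, ‖q j‖ ≤ 1)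
    (hM : (pickMatrix x q).PosSemidef) (h : pickMatrix x q ≠ 0) : ∀ j, ‖q j‖ < 1 := by
  by_contra hcon
  push Not at hcon
  obtain ⟨j, hj⟩ := hcon
  have hj1 : ‖q j‖ = 1 := le_antisymm (hq j) hj
  have hdet := hM.det_nonneg
  rw [det_pickMatrix_eq_sub, Complex.zero_le_real] at hdet
  have h0 : (1 - ‖q 0‖ ^ 2) / (1 - ‖x 0‖ ^ 2) * ((1 - ‖q 1‖ ^ 2) / (1 - ‖x 1‖ ^ 2)) = 0 := by
    fin_cases j
    · have : ‖q 0‖ = 1 := hj1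
      simp [this]
    · have : ‖q 1‖ = 1 := hj1
      simp [this]
  have h01 : pickMatrix x q 0 1 = 0 := by
    rw [h0] at hdet
    exact norm_eq_zero.mp (pow_eq_zero_iff two_ne_zero |>.mp
      (le_antisymm (by linarith) (sq_nonneg _)))
  have h10 : pickMatrix x q 1 0 = 0 := by rw [← conj_pickMatrix, h01, map_zero]
  have hone : ‖q 0‖ * ‖q 1‖ = 1 := by
    have h01' := h01
    rw [pickMatrix, Matrix.of_apply, div_eq_zero_iff] at h01'
    have := h01'.resolve_right (by
      rw [mul_comm]
      exact one_sub_conj_mul_ne (hx 1) (hx 0))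
    simpa using congrArg norm (sub_eq_zero.mp this).symm
  have hq0 : ‖q 0‖ = 1 := by nlinarith [hq 0, hq 1, norm_nonneg (q 0), norm_nonneg (q 1)]
  have hq1 : ‖q 1‖ = 1 := by nlinarith [hq 0, hq 1, norm_nonneg (q 0), norm_nonneg (q 1)]
  apply h
  ext i k
  fin_cases i <;> fin_cases k
  · simpa [hq0] using pickMatrix_apply_self (x := x) (q := q) 0
  · exact h01
  · exact h10
  · simpa [hq1] using pickMatrix_apply_self (x := x) (q := q) 1

theorem norm_psi_eq_of_det_eq_zero (hx : ∀ j, ‖x j‖ < 1) (hq : ∀ j, ‖q j‖ < 1)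
    (h : (pickMatrix x q).det = 0) : ‖psi (q 1) (q 0)‖ = ‖psi (x 1) (x 0)‖ := by
  have hX := norm_pos_iff.mpr (one_sub_conj_mul_ne (hx 1) (hx 0))
  have hQ := norm_pos_iff.mpr (one_sub_conj_mul_ne (hq 1) (hq 0))
  rw [det_pickMatrix hx, Complex.ofReal_eq_zero, div_eq_zero_iff] at h
  have h1 := h.resolve_right (det_pickMatrix_denom_pos hx).ne'
  rw [psi, psi, norm_div, norm_div, div_eq_div_iff hQ.ne' hX.ne']
  refine (pow_left_inj₀ (by positivity) (by positivity) two_ne_zero).mp ?_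
  rw [mul_pow, mul_pow]
  linarith

theorem norm_psi_lt_of_det_ne_zero (hx : ∀ j, ‖x j‖ < 1) (hq : ∀ j, ‖q j‖ < 1)
    (hM : (pickMatrix x q).PosSemidef) (h : (pickMatrix x q).det ≠ 0) :
    ‖psi (q 1) (q 0)‖ < ‖psi (x 1) (x 0)‖ := by
  have hX := norm_pos_iff.mpr (one_sub_conj_mul_ne (hx 1) (hx 0))
  have hQ := norm_pos_iff.mpr (one_sub_conj_mul_ne (hq 1) (hq 0))
  have hdet := lt_of_le_of_ne hM.det_nonneg h.symm
  rw [det_pickMatrix hx, Complex.zero_lt_real,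
    div_pos_iff_of_pos_right (det_pickMatrix_denom_pos hx)] at hdet
  rw [psi, psi, norm_div, norm_div, div_lt_div_iff₀ hQ hX]
  refine lt_of_pow_lt_pow_left₀ 2 (by positivity) ?_
  rw [mul_pow, mul_pow]
  linarith

theorem exists_blaschke_one (hx : ∀ j, ‖x j‖ < 1) (hq : ∀ j, ‖q j‖ < 1)
    (h : (pickMatrix x q).det = 0) :
    ∃ B, IsBlaschkeProduct 1 B ∧ ∀ j, B (x j) = q j := by
  have hn := norm_psi_eq_of_det_eq_zero hx hq h
  obtain ⟨c, hc, hcx⟩ : ∃ c : ℂ, ‖c‖ = 1 ∧ c * psi (x 1) (x 0) = psi (q 1) (q 0) := by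
    by_cases h0 : psi (x 1) (x 0) = 0
    · rw [h0, norm_zero, norm_eq_zero] at hn
      exact ⟨1, norm_one, by rw [h0, hn, mul_zero]⟩
    · exact ⟨psi (q 1) (q 0) / psi (x 1) (x 0),
        by rw [norm_div, hn, div_self (norm_ne_zero_iff.mpr h0)], div_mul_cancel₀ _ h0⟩
  refine ⟨_, (IsBlaschkeProduct.const_mul_psi hc (hx 1)).psiInv_comp (hq 1), fun j => ?_⟩
  fin_cases j
  · change psiInv (q 1) (c * psi (x 1) (x 0)) = q 0
    rw [hcx, psiInv_psi (hq 1) (hq 0)]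
  · change psiInv (q 1) (c * psi (x 1) (x 1)) = q 1
    rw [psi_self, mul_zero, psiInv_zero]

/-- One step of Schur's algorithm: after `ψ_{q 1}` a factor `ψ_{x 1}` can be split off, and the
remaining factor of degree one has a prescribed value at `x 0` only. -/
theorem exists_blaschke_two (hx : ∀ j, ‖x j‖ < 1) (hq : ∀ j, ‖q j‖ < 1)
    (hM : (pickMatrix x q).PosSemidef) (h : (pickMatrix x q).det ≠ 0) :
    ∃ B, IsBlaschkeProduct 2 B ∧ ∀ j, B (x j) = q j := by
  have hn := norm_psi_lt_of_det_ne_zero hx hq hM h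
  have hpos : 0 < ‖psi (x 1) (x 0)‖ := (norm_nonneg _).trans_lt hn
  have ht : ‖psi (q 1) (q 0) / psi (x 1) (x 0)‖ < 1 := by rwa [norm_div, div_lt_one hpos]
  refine ⟨_, (((IsBlaschkeProduct.const_mul_psi norm_one (hx 0)).psiInv_comp ht).psi_mul
    (hx 1)).psiInv_comp (hq 1), fun j => ?_⟩
  fin_cases j
  · change psiInv (q 1) (psi (x 1) (x 0) *
      psiInv (psi (q 1) (q 0) / psi (x 1) (x 0)) (1 * psi (x 0) (x 0))) = q 0
    rw [psi_self, mul_zero, psiInv_zero, mul_div_cancel₀ _ (norm_pos_iff.mp hpos),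
      psiInv_psi (hq 1) (hq 0)]
  · change psiInv (q 1) (psi (x 1) (x 1) * _) = q 1
    rw [psi_self, zero_mul, psiInv_zero]

end Pick

theorem det_ne_zero_of_rank_eq_two {M : Matrix (Fin 2) (Fin 2) ℂ} (h : M.rank = 2) :
    M.det ≠ 0 := by
  have htop : LinearMap.range M.mulVecLin = ⊤ :=
    Submodule.eq_top_of_finrank_eq (by rw [← Matrix.rank, h]; simp)
  have hu : IsUnit M := Matrix.mulVec_surjective_iff_isUnit.mp (LinearMap.range_eq_top.mp htop)
  exact ((Matrix.isUnit_iff_isUnit_det M).mp hu).ne_zero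

/-! ### Interpolation at three points -/

section Interpolation

variable {n : ℕ} {X : Fin 3 → Fin n → ℂ} {w : Fin 3 → ℂ}

theorem node_mem (hX : ∀ j, X j ∈ polydisc n) (j : Fin 2) : node X j ∈ polydisc n :=
  Psi_mem_polydisc (hX _) (hX _)

/-- A factor `g` with the values `q j` at the nodes produces an interpolant; the third condition
holds because `H` vanishes at the origin. -/
theorem isInterpolant_of_mul (hX : ∀ j, X j ∈ polydisc n) (hw : ∀ j, ‖w j‖ < 1)
    {H g : (Fin n → ℂ) → ℂ} {q : Fin 2 → ℂ} (hH : IsRationalInner H) (hH0 : HasSpecialForm H)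
    (hq : IsQuotientPair X w H q) (hg : IsRationalInner g) (hgq : ∀ j, g (node X j) = q j) :
    IsInterpolant X w fun z => psiInv (w 2) (g (Psi (X 2) z) * H (Psi (X 2) z)) := by
  refine ⟨((hg.mul hH).comp_Psi (hX 2)).psiInv_comp (hw 2), fun j => ?_⟩
  have hnode : ∀ j : Fin 2, psiInv (w 2) (g (Psi (X 2) (X j.castSucc)) *
      H (Psi (X 2) (X j.castSucc))) = w j.castSucc := by
    intro j
    change psiInv (w 2) (g (node X j) * H (node X j)) = _
    rw [hgq, (hq j).2, value, psiInv_psi (hw 2) (hw _)]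
  refine Fin.lastCases ?_ hnode j
  change psiInv (w 2) (g (Psi (X 2) (X 2)) * H (Psi (X 2) (X 2))) = w 2
  rw [Psi_self, hH0.apply_zero, mul_zero, psiInv_zero]

theorem exists_special_of_isInterpolant [Nonempty (Fin n)] (hX : ∀ j, X j ∈ polydisc n)
    (hw : ∀ j, ‖w j‖ < 1) {F : (Fin n → ℂ) → ℂ} (hF : IsInterpolant X w F) :
    ∃ H : (Fin n → ℂ) → ℂ, IsRationalInner H ∧ HasSpecialForm H ∧
      ∃ q : Fin 2 → ℂ, IsQuotientPair X w H q ∧ ∃ l : Fin n, (dataMatrix X q l).PosSemidef := by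
  have hG := (hF.1.comp_Psi (neg_mem_polydisc (hX 2))).psi_comp (hw 2)
  obtain ⟨H, K, hH, hHs, hK, hKH⟩ := hG.exists_special_factor (by
    rw [Psi_neg_zero, hF.2, psi_self])
  have hnode := node_mem hX
  obtain ⟨l, hl⟩ := hK.exists_norm_sub_mul_le (hnode 0) (hnode 1)
  refine ⟨H, hH, hHs, fun j => K (node X j), fun j => ⟨hK.norm_le_one (hnode j), ?_⟩, l,
    posSemidef_pickMatrix (fun j => hnode j l) (fun j => hK.norm_le_one (hnode j)) hl⟩
  rw [hKH _ (hnode j), node, Psi_neg_Psi (hX 2) (hX _), hF.2, value]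

theorem exists_isInterpolant_const (hX : ∀ j, X j ∈ polydisc n) (hw : ∀ j, ‖w j‖ < 1)
    {H : (Fin n → ℂ) → ℂ} {q : Fin 2 → ℂ} {l : Fin n} (hH : IsRationalInner H)
    (hHs : HasSpecialForm H) (hq : IsQuotientPair X w H q) (hM : dataMatrix X q l = 0) :
    ∃ c : ℂ, ‖c‖ = 1 ∧ IsInterpolant X w fun z => psiInv (w 2) (c * H (Psi (X 2) z)) := by
  obtain ⟨hc, hq01⟩ := norm_eq_one_of_pickMatrix_eq_zero (fun j => node_mem hX j l) hM
  refine ⟨q 0, hc, isInterpolant_of_mul hX hw hH hHs hq (.const hc) fun j => ?_⟩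
  fin_cases j
  · rfl
  · exact hq01

theorem isInterpolant_of_blaschke (hX : ∀ j, X j ∈ polydisc n) (hw : ∀ j, ‖w j‖ < 1)
    {H : (Fin n → ℂ) → ℂ} {q : Fin 2 → ℂ} {l : Fin n} (hH : IsRationalInner H)
    (hHs : HasSpecialForm H) (hq : IsQuotientPair X w H q) {r : ℕ} {B : ℂ → ℂ}
    (hB : IsBlaschkeProduct r B) (hBq : ∀ j, B (node X j l) = q j) :
    IsInterpolant X w fun z =>
      psiInv (w 2) (B (Psi (X 2) z l) * H (Psi (X 2) z)) :=
  isInterpolant_of_mul hX hw hH hHs hq (.blaschke_coord hB l) hBq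

end Interpolation

end PolydiscPick

theorem theorem1p1 (n : ℕ) (hn : 2 ≤ n)
    (X : Fin 3 → Fin n → ℂ) (hX : ∀ j, X j ∈ PolydiscPick.polydisc n)
    (hXinj : Function.Injective X)
    (w : Fin 3 → ℂ) (hw : ∀ j, ‖w j‖ < 1) :
    ((∃ F : (Fin n → ℂ) → ℂ, PolydiscPick.IsInterpolant X w F) ↔
      ∃ H : (Fin n → ℂ) → ℂ, PolydiscPick.IsRationalInner H ∧ PolydiscPick.HasSpecialForm H ∧
        ∃ q : Fin 2 → ℂ, PolydiscPick.IsQuotientPair X w H q ∧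
          ∃ l : Fin n, (PolydiscPick.dataMatrix X q l).PosSemidef) ∧
    (∀ (H : (Fin n → ℂ) → ℂ) (q : Fin 2 → ℂ) (l : Fin n),
      PolydiscPick.IsRationalInner H → PolydiscPick.HasSpecialForm H →
      PolydiscPick.IsQuotientPair X w H q → (PolydiscPick.dataMatrix X q l).PosSemidef →
      (PolydiscPick.dataMatrix X q l = 0 →
        ∃ c : ℂ, ‖c‖ = 1 ∧
          PolydiscPick.IsInterpolant X w
            (fun z => PolydiscPick.psiInv (w 2) (c * H (PolydiscPick.Psi (X 2) z)))) ∧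
      (∀ r : ℕ, r = 1 ∨ r = 2 → (PolydiscPick.dataMatrix X q l).rank = r →
        ∃ B : ℂ → ℂ, PolydiscPick.IsBlaschkeProduct r B ∧
          PolydiscPick.IsInterpolant X w
            (fun z => PolydiscPick.psiInv (w 2)
              (B (PolydiscPick.Psi (X 2) z l) * H (PolydiscPick.Psi (X 2) z))))) := by
  open PolydiscPick in
  have : Nonempty (Fin n) := ⟨⟨0, by omega⟩⟩
  have hx : ∀ (l : Fin n) (j : Fin 2), ‖node X j l‖ < 1 := fun l j => node_mem hX j l
  refine ⟨⟨fun ⟨F, hF⟩ => exists_special_of_isInterpolant hX hw hF, ?_⟩, ?_⟩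
  · rintro ⟨H, hH, hHs, q, hq, l, hM⟩
    by_cases h0 : dataMatrix X q l = 0
    · obtain ⟨c, -, hF⟩ := exists_isInterpolant_const hX hw hH hHs hq h0
      exact ⟨_, hF⟩
    have hq1 := norm_lt_one_of_pickMatrix_ne_zero (hx l) (fun j => (hq j).1) hM h0
    by_cases hdet : (dataMatrix X q l).det = 0
    · obtain ⟨B, hB, hBq⟩ := exists_blaschke_one (hx l) hq1 hdet
      exact ⟨_, isInterpolant_of_blaschke hX hw hH hHs hq hB hBq⟩
    · obtain ⟨B, hB, hBq⟩ := exists_blaschke_two (hx l) hq1 hM hdet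
      exact ⟨_, isInterpolant_of_blaschke hX hw hH hHs hq hB hBq⟩
  · intro H q l hH hHs hq hM
    refine ⟨exists_isInterpolant_const hX hw hH hHs hq, fun r hr hrank => ?_⟩
    have h0 : dataMatrix X q l ≠ 0 := by
      intro h0
      rw [h0, Matrix.rank_zero] at hrank
      omega
    have hq1 := norm_lt_one_of_pickMatrix_ne_zero (hx l) (fun j => (hq j).1) hM h0
    obtain ⟨B, hB, hBq⟩ : ∃ B, IsBlaschkeProduct r B ∧ ∀ j, B (node X j l) = q j := by
      rcases hr with rfl | rfl
      · refine exists_blaschke_one (hx l) hq1 ?_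
        by_contra hdet
        have := Matrix.rank_of_det_ne_zero hdet
        rw [dataMatrix] at hrank
        simp [hrank] at this
      · exact exists_blaschke_two (hx l) hq1 hM (det_ne_zero_of_rank_eq_two hrank)
    exact ⟨B, hB, isInterpolant_of_blaschke hX hw hH hHs hq hB hBq⟩
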